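/- Let $\mathcal Q$ be a unital $C^*$-algebra (for instance, the one underlying a compact quantum group). All Hilbert spaces below are finite-dimensional and complex, $\bar H$ is the complex conjugate Hilbert space of $H$, and $B(H,K)\otimes\mathcal Q$ is the algebraic tensor product. Let $\alpha$ be the category defined as follows. Objects: pairs $(U,H)$, where $H$ is a finite-dimensional Hilbert space and $U\in B(H)\otimes\mathcal Q$ is unitary, such that there exist a unitary $\bar U\in B(\bar H)\otimes\mathcal Q$ and linear maps $R_s:\mathbb C\to\bar H\otimes H$ and $R_t:\mathbb C\to H\otimes\bar H$ with $$R_s\otimes 1=(\bar U_{13}U_{23})(R_s\otimes 1),\qquad R_t\otimes 1=(U_{13}\bar U_{23})(R_t\otimes 1),$$ $$(R_s^*\otimes \mathrm{id}_{\bar H})(\mathrm{id}_{\bar H}\otimes R_t)=\mathrm{id}_{\bar H},\qquad (R_t^*\otimes \mathrm{id}_{H})(\mathrm{id}_{H}\otimes R_s)=\mathrm{id}_{H}.$$ Morphisms: $\mathrm{Mor}((U,H),(V,K))=\{T\in B(H,K): V(T\otimes 1)=(T\otimes 1)U\}$, with composition, adjoint and norm of operators. Tensor product: $(U,H)\otimes(V,K)=(U_{13}V_{23},H\otimes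 K)$ on objects and the tensor product of operators on morphisms; the unit object is $(1,\mathbb C)$. Then $\alpha$ contains the unit object, is closed under tensor products, and is a rigid strict $C^*$-tensor category. In detail: 1. $\alpha$ is a $C^*$-category: the morphism spaces are Banach spaces, composition is bilinear and submultiplicative, $T\mapsto T^*$ is an antilinear involutive contravariant functor that is the identity on objects, $\|T^*T\|=\|T\|^2$, and for every morphism $T$ with source $X$ there is $S\in\mathrm{End}(X)$ with $T^*T=S^*S$. 2. The tensor product is a bilinear bifunctor with $(S\otimes T)^*=S^*\otimes T^*$. Its associativity and unit constraints are unitary intertwiners, satisfy the pentagon and triangle axioms, and are strict in the sense that they are the canonical identifications $(H\otimes K)\otimes L=H\otimes(K\otimes L)$ and $\mathbb C\otimes H=H=H\otimes\mathbb C$ of Hilbert spaces. The unit object is simple: its endomorphisms are the scalars, and they form a one-dimensional space. 3. $\alpha$ has direct sums (for all $X,Y$ there are an object $Z$ and isometries $u:X\to Z$, $v:Y\to Z$ with $uu^*+vv^*=1$) and subobjects (for every projection $p\in\mathrm{End}(X)$ there are an object $Y$ and an isometry $v:Y\to X$ with $vv^*=p$). 4. $\alpha$ is rigid: every object $X$ has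 a conjugate object $Y$ in $\alpha$, that is, there are morphisms $R:1\to Y\otimes X$ and $R':1\to X\otimes Y$ of $\alpha$ with $(R^*\otimes\mathrm{id}_Y)(\mathrm{id}_Y\otimes R')=\mathrm{id}_Y$ and $(R'^*\otimes\mathrm{id}_X)(\mathrm{id}_X\otimes R)=\mathrm{id}_X$. 5. Inside the category of all pairs $(U,H)$ with $U\in B(H)\otimes\mathcal Q$ unitary, with all intertwiners as morphisms, $\alpha$ is closed under direct sums, subobjects and conjugates: if a pair is a direct sum of two objects of $\alpha$, or admits an isometric intertwiner into an object of $\alpha$, or is a conjugate of an object of $\alpha$ (as in 4, with $R,R'$ intertwiners), then it is an object of $\alpha$. -/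

import Mathlib

open CategoryTheory MonoidalCategory
open scoped TensorProduct

noncomputable section

namespace AlphaCat

/-! ### C*-tensor categories

Composition is written in diagrammatic order: `T ≫ S` is the operator product `S T`. -/

/-- The extra data of a C*-category: an adjoint operation and a norm on morphisms. -/
class HasDagNorm (C : Type*) [Category C] where
  /-- the adjoint `T ↦ T*` -/
  dag : ∀ {X Y : C}, (X ⟶ Y) → (Y ⟶ X)
  /-- the norm of a morphism -/
  mnorm : ∀ {X Y : C}, (X ⟶ Y) → ℝ

open HasDagNorm

/-- `v* v = 1`. -/
def IsIsometry {C : Type*} [Category C] [HasDagNorm C] {X Y : C} (v : X ⟶ Y) : Prop :=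
  v ≫ dag v = 𝟙 X

/-- `v* v = 1` and `v v* = 1`. -/
def IsUnitaryMor {C : Type*} [Category C] [HasDagNorm C] {X Y : C} (v : X ⟶ Y) : Prop :=
  v ≫ dag v = 𝟙 X ∧ dag v ≫ v = 𝟙 Y

/-- A C*-category: the morphism spaces are complex Banach spaces, composition is bilinear (this is
part of `Preadditive` and `Linear`) and submultiplicative, the adjoint is an antilinear involutive
contravariant functor which is the identity on objects, the C*-identity holds, and each `T* T` is
positive in the C*-algebra `End X`. -/
structure IsCStarCategory (C : Type*) [Category C] [Preadditive C] [Linear ℂ C] [HasDagNorm C] :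
    Prop where
  mnorm_eq_zero_iff : ∀ {X Y : C} (T : X ⟶ Y), mnorm T = 0 ↔ T = 0
  mnorm_add_le : ∀ {X Y : C} (S T : X ⟶ Y), mnorm (S + T) ≤ mnorm S + mnorm T
  mnorm_smul : ∀ {X Y : C} (z : ℂ) (T : X ⟶ Y), mnorm (z • T) = ‖z‖ * mnorm T
  complete : ∀ {X Y : C} (u : ℕ → (X ⟶ Y)),
    (∀ ε > 0, ∃ N, ∀ m ≥ N, ∀ n ≥ N, mnorm (u m - u n) < ε) →
    ∃ T : X ⟶ Y, ∀ ε > 0, ∃ N, ∀ n ≥ N, mnorm (u n - T) < ε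
  mnorm_comp_le : ∀ {X Y Z : C} (T : X ⟶ Y) (S : Y ⟶ Z), mnorm (T ≫ S) ≤ mnorm S * mnorm T
  dag_add : ∀ {X Y : C} (S T : X ⟶ Y), dag (S + T) = dag S + dag T
  dag_smul : ∀ {X Y : C} (z : ℂ) (T : X ⟶ Y), dag (z • T) = (starRingEnd ℂ z) • dag T
  dag_id : ∀ X : C, dag (𝟙 X) = 𝟙 X
  dag_comp : ∀ {X Y Z : C} (T : X ⟶ Y) (S : Y ⟶ Z), dag (T ≫ S) = dag S ≫ dag T
  dag_dag : ∀ {X Y : C} (T : X ⟶ Y), dag (dag T) = T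
  cstar : ∀ {X Y : C} (T : X ⟶ Y), mnorm (T ≫ dag T) = mnorm T ^ 2
  positive : ∀ {X Y : C} (T : X ⟶ Y), ∃ S : X ⟶ X, T ≫ dag T = S ≫ dag S

/-- A C*-tensor category: a C*-category with a bilinear tensor product that is compatible with
adjoints, unitary associativity and unit constraints (naturality, pentagon and triangle are part of
`MonoidalCategory`), finite direct sums, subobjects, and a simple unit object. -/
structure IsCStarTensorCategory (C : Type*) [Category C] [Preadditive C] [Linear ℂ C]
    [HasDagNorm C] [MonoidalCategory C] : Prop extends IsCStarCategory C where
  add_tensor : ∀ {X Y X' Y' : C} (S T : X ⟶ Y) (R : X' ⟶ Y'),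
    (S + T) ⊗ₘ R = (S ⊗ₘ R) + (T ⊗ₘ R)
  tensor_add : ∀ {X Y X' Y' : C} (R : X ⟶ Y) (S T : X' ⟶ Y'),
    R ⊗ₘ (S + T) = (R ⊗ₘ S) + (R ⊗ₘ T)
  smul_tensor : ∀ {X Y X' Y' : C} (z : ℂ) (S : X ⟶ Y) (T : X' ⟶ Y'),
    (z • S) ⊗ₘ T = z • (S ⊗ₘ T)
  tensor_smul : ∀ {X Y X' Y' : C} (z : ℂ) (S : X ⟶ Y) (T : X' ⟶ Y'),
    S ⊗ₘ (z • T) = z • (S ⊗ₘ T)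
  dag_tensor : ∀ {X Y X' Y' : C} (S : X ⟶ Y) (T : X' ⟶ Y'), dag (S ⊗ₘ T) = dag S ⊗ₘ dag T
  associator_unitary : ∀ X Y Z : C, IsUnitaryMor (α_ X Y Z).hom
  leftUnitor_unitary : ∀ X : C, IsUnitaryMor (λ_ X).hom
  rightUnitor_unitary : ∀ X : C, IsUnitaryMor (ρ_ X).hom
  exists_directSum : ∀ X Y : C, ∃ (Z : C) (u : X ⟶ Z) (v : Y ⟶ Z),
    IsIsometry u ∧ IsIsometry v ∧ dag u ≫ u + dag v ≫ v = 𝟙 Z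
  exists_subobject : ∀ (X : C) (p : X ⟶ X), dag p = p → p ≫ p = p →
    ∃ (Y : C) (v : Y ⟶ X), IsIsometry v ∧ dag v ≫ v = p
  id_unit_ne_zero : 𝟙 (𝟙_ C) ≠ 0
  end_unit : ∀ T : 𝟙_ C ⟶ 𝟙_ C, ∃ z : ℂ, T = z • 𝟙 (𝟙_ C)

/-- `R : 1 ⟶ Y ⊗ X` and `R' : 1 ⟶ X ⊗ Y` solve the conjugate equations
`(R* ⊗ id_Y)(id_Y ⊗ R') = id_Y` and `(R'* ⊗ id_X)(id_X ⊗ R) = id_X`. -/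
def SolvesConjugateEquations {C : Type*} [Category C] [MonoidalCategory C] [HasDagNorm C] {X Y : C}
    (R : 𝟙_ C ⟶ Y ⊗ X) (R' : 𝟙_ C ⟶ X ⊗ Y) : Prop :=
  (ρ_ Y).inv ≫ (Y ◁ R') ≫ (α_ Y X Y).inv ≫ (dag R ▷ Y) ≫ (λ_ Y).hom = 𝟙 Y ∧
  (ρ_ X).inv ≫ (X ◁ R) ≫ (α_ X Y X).inv ≫ (dag R' ▷ X) ≫ (λ_ X).hom = 𝟙 X

/-- `Y` is a conjugate object of `X`. -/
def IsConjugate {C : Type*} [Category C] [MonoidalCategory C] [HasDagNorm C] (X Y : C) : Prop :=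
  ∃ (R : 𝟙_ C ⟶ Y ⊗ X) (R' : 𝟙_ C ⟶ X ⊗ Y), SolvesConjugateEquations R R'

/-- A rigid C*-tensor category: every object has a conjugate object. -/
structure IsRigidCStarTensorCategory (C : Type*) [Category C] [Preadditive C] [Linear ℂ C]
    [HasDagNorm C] [MonoidalCategory C] : Prop extends IsCStarTensorCategory C where
  exists_conjugate : ∀ X : C, ∃ Y : C, IsConjugate X Y

/-- A full subcategory inherits adjoints and norms. -/
instance {C : Type*} [Category C] [HasDagNorm C] (P : ObjectProperty C) :
    HasDagNorm P.FullSubcategory where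
  dag T := ObjectProperty.homMk (dag T.hom)
  mnorm T := mnorm T.hom

/-! ### The conjugate Hilbert space -/

/-- The complex conjugate `H̄` of a Hilbert space `H`: the same additive group and norm, with
`z • ξ̄ = overline (conj z • ξ)` and `⟨ξ̄, η̄⟩ = ⟨η, ξ⟩`. -/
def ConjSpace (H : Type) : Type := H

section ConjSpace

variable (H : Type) [NormedAddCommGroup H] [InnerProductSpace ℂ H]

instance : NormedAddCommGroup (ConjSpace H) := inferInstanceAs (NormedAddCommGroup H)

instance : Module ℂ (ConjSpace H) := Module.compHom H (starRingEnd ℂ)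

instance : InnerProductSpace ℂ (ConjSpace H) where
  norm_smul_le z x := by
    have h : ‖(starRingEnd ℂ z) • (show H from x)‖ ≤ ‖starRingEnd ℂ z‖ * ‖(show H from x)‖ :=
      norm_smul_le _ _
    rw [RCLike.norm_conj] at h
    exact h
  inner x y := inner ℂ (show H from y) (show H from x)
  norm_sq_eq_re_inner x := norm_sq_eq_re_inner (𝕜 := ℂ) (show H from x)
  conj_inner_symm x y := inner_conj_symm (𝕜 := ℂ) (show H from y) (show H from x)
  add_left x y z := inner_add_right (𝕜 := ℂ) (show H from z) (show H from x) (show H from y)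
  smul_left x y r :=
    inner_smul_right (𝕜 := ℂ) (show H from y) (show H from x) (starRingEnd ℂ r)

/-- The identity `ξ ↦ ξ̄` as an antilinear bijection. -/
def toConjSpace : H ≃ₛₗ[starRingEnd ℂ] ConjSpace H where
  toFun x := x
  invFun x := x
  map_add' _ _ := rfl
  map_smul' z x := by
    change z • (show H from x) = (starRingEnd ℂ (starRingEnd ℂ z)) • (show H from x)
    rw [Complex.conj_conj]
  left_inv _ := rfl
  right_inv _ := rfl

instance [FiniteDimensional ℂ H] : FiniteDimensional ℂ (ConjSpace H) :=
  Module.Finite.of_surjective (toConjSpace H).toLinearMap (toConjSpace H).surjective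

end ConjSpace

/-! ### Operators with coefficients in `Q`

For finite-dimensional `H`, `K` the (algebraic) tensor product `B(H, K) ⊗ Q` is the usual one. -/

section QOperators

variable {Q : Type*} [CStarAlgebra Q]

section Algebraic

variable {H H' H'' H₃ K K' K'' L : Type}
  [AddCommGroup H] [Module ℂ H] [AddCommGroup H'] [Module ℂ H']
  [AddCommGroup H''] [Module ℂ H''] [AddCommGroup H₃] [Module ℂ H₃]
  [AddCommGroup K] [Module ℂ K] [AddCommGroup K'] [Module ℂ K']
  [AddCommGroup K''] [Module ℂ K''] [AddCommGroup L] [Module ℂ L]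

/-- The product `(S ⊗ a)(T ⊗ b) = ST ⊗ ab`. -/
def qmul : ((H' →ₗ[ℂ] H'') ⊗[ℂ] Q) →ₗ[ℂ] ((H →ₗ[ℂ] H') ⊗[ℂ] Q) →ₗ[ℂ]
    ((H →ₗ[ℂ] H'') ⊗[ℂ] Q) :=
  TensorProduct.map₂ (LinearMap.llcomp ℂ H H' H'') (LinearMap.mul ℂ Q)

/-- `(T ⊗ a) ↦ T ⊗ id_K ⊗ a`, that is `x ↦ x₁₃`. -/
def leg13 (K : Type) [AddCommGroup K] [Module ℂ K] :
    ((H →ₗ[ℂ] H') ⊗[ℂ] Q) →ₗ[ℂ] ((H ⊗[ℂ] K →ₗ[ℂ] H' ⊗[ℂ] K) ⊗[ℂ] Q) :=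
  LinearMap.rTensor Q (LinearMap.rTensorHom K)

/-- `(T ⊗ a) ↦ id_H ⊗ T ⊗ a`, that is `x ↦ x₂₃`. -/
def leg23 (H : Type) [AddCommGroup H] [Module ℂ H] :
    ((K →ₗ[ℂ] K') ⊗[ℂ] Q) →ₗ[ℂ] ((H ⊗[ℂ] K →ₗ[ℂ] H ⊗[ℂ] K') ⊗[ℂ] Q) :=
  LinearMap.rTensor Q (LinearMap.lTensorHom H)

@[simp] lemma qmul_tmul (S : H' →ₗ[ℂ] H'') (T : H →ₗ[ℂ] H') (a b : Q) :
    qmul (S ⊗ₜ[ℂ] a) (T ⊗ₜ[ℂ] b) = (S ∘ₗ T) ⊗ₜ[ℂ] (a * b) := rfl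

@[simp] lemma leg13_tmul (T : H →ₗ[ℂ] H') (a : Q) :
    leg13 K (T ⊗ₜ[ℂ] a) = (LinearMap.rTensor K T) ⊗ₜ[ℂ] a := rfl

@[simp] lemma leg23_tmul (T : K →ₗ[ℂ] K') (a : Q) :
    leg23 H (T ⊗ₜ[ℂ] a) = (LinearMap.lTensor H T) ⊗ₜ[ℂ] a := rfl

lemma qmul_eq_mul (x y : Module.End ℂ H ⊗[ℂ] Q) : qmul x y = x * y := by
  induction x using TensorProduct.induction_on with
  | zero => simp
  | add x₁ x₂ h₁ h₂ => simp [h₁, h₂, add_mul]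
  | tmul S a =>
    induction y using TensorProduct.induction_on with
    | zero => simp
    | add x₁ x₂ h₁ h₂ => simp [h₁, h₂, mul_add]
    | tmul T b =>
      rw [Algebra.TensorProduct.tmul_mul_tmul]
      rfl

lemma qmul_assoc (x : (H'' →ₗ[ℂ] H₃) ⊗[ℂ] Q) (y : (H' →ₗ[ℂ] H'') ⊗[ℂ] Q)
    (z : (H →ₗ[ℂ] H') ⊗[ℂ] Q) : qmul (qmul x y) z = qmul x (qmul y z) := by
  induction x using TensorProduct.induction_on with
  | zero => simp
  | add x₁ x₂ h₁ h₂ => simp [h₁, h₂]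
  | tmul S a =>
    induction y using TensorProduct.induction_on with
    | zero => simp
    | add x₁ x₂ h₁ h₂ => simp [h₁, h₂]
    | tmul T b =>
      induction z using TensorProduct.induction_on with
      | zero => simp
      | add x₁ x₂ h₁ h₂ => simp only [map_add, h₁, h₂]
      | tmul R c => simp [mul_assoc, LinearMap.comp_assoc]

lemma one_qmul (x : (H →ₗ[ℂ] H') ⊗[ℂ] Q) : qmul (LinearMap.id ⊗ₜ[ℂ] 1) x = x := by
  induction x using TensorProduct.induction_on with
  | zero => simp
  | add x₁ x₂ h₁ h₂ => simp [h₁, h₂]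
  | tmul S a => simp

lemma qmul_one (x : (H →ₗ[ℂ] H') ⊗[ℂ] Q) : qmul x (LinearMap.id ⊗ₜ[ℂ] 1) = x := by
  induction x using TensorProduct.induction_on with
  | zero => simp
  | add x₁ x₂ h₁ h₂ => simp [h₁, h₂]
  | tmul S a => simp

lemma leg13_qmul (x : (H' →ₗ[ℂ] H'') ⊗[ℂ] Q) (y : (H →ₗ[ℂ] H') ⊗[ℂ] Q) :
    leg13 K (qmul x y) = qmul (leg13 K x) (leg13 K y) := by
  induction x using TensorProduct.induction_on with
  | zero => simp
  | add x₁ x₂ h₁ h₂ => simp [h₁, h₂]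
  | tmul S a =>
    induction y using TensorProduct.induction_on with
    | zero => simp
    | add x₁ x₂ h₁ h₂ => simp [h₁, h₂]
    | tmul T b => simp [LinearMap.rTensor_comp]

lemma leg23_qmul (x : (K' →ₗ[ℂ] K'') ⊗[ℂ] Q) (y : (K →ₗ[ℂ] K') ⊗[ℂ] Q) :
    leg23 H (qmul x y) = qmul (leg23 H x) (leg23 H y) := by
  induction x using TensorProduct.induction_on with
  | zero => simp
  | add x₁ x₂ h₁ h₂ => simp [h₁, h₂]
  | tmul S a =>
    induction y using TensorProduct.induction_on with
    | zero => simp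
    | add x₁ x₂ h₁ h₂ => simp [h₁, h₂]
    | tmul T b => simp [LinearMap.lTensor_comp]

lemma leg13_comm (T : H →ₗ[ℂ] H') (y : (K →ₗ[ℂ] K') ⊗[ℂ] Q) :
    qmul (leg13 K' (T ⊗ₜ[ℂ] 1)) (leg23 H y) = qmul (leg23 H' y) (leg13 K (T ⊗ₜ[ℂ] 1)) := by
  induction y using TensorProduct.induction_on with
  | zero => simp
  | add x₁ x₂ h₁ h₂ => simp only [map_add, h₁, h₂, LinearMap.add_apply]
  | tmul S a => simp

lemma leg23_comm (S : K →ₗ[ℂ] K') (x : (H →ₗ[ℂ] H') ⊗[ℂ] Q) :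
    qmul (leg23 H' (S ⊗ₜ[ℂ] 1)) (leg13 K x) = qmul (leg13 K' x) (leg23 H (S ⊗ₜ[ℂ] 1)) := by
  induction x using TensorProduct.induction_on with
  | zero => simp
  | add x₁ x₂ h₁ h₂ => simp only [map_add, h₁, h₂, LinearMap.add_apply]
  | tmul T a => simp

lemma leg13_one : (leg13 K (1 : Module.End ℂ H ⊗[ℂ] Q) : Module.End ℂ (H ⊗[ℂ] K) ⊗[ℂ] Q) = 1 := by
  rw [Algebra.TensorProduct.one_def, leg13_tmul, Module.End.one_eq_id, LinearMap.rTensor_id]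
  rfl

lemma leg23_one : (leg23 H (1 : Module.End ℂ K ⊗[ℂ] Q) : Module.End ℂ (H ⊗[ℂ] K) ⊗[ℂ] Q) = 1 := by
  rw [Algebra.TensorProduct.one_def, leg23_tmul, Module.End.one_eq_id, LinearMap.lTensor_id]
  rfl

/-- `T : H → H'` intertwines `U` and `V`: `(T ⊗ 1) U = V (T ⊗ 1)`. -/
def Intertwines (T : H →ₗ[ℂ] H') (U : Module.End ℂ H ⊗[ℂ] Q) (V : Module.End ℂ H' ⊗[ℂ] Q) : Prop :=
  qmul (T ⊗ₜ[ℂ] (1 : Q)) U = qmul V (T ⊗ₜ[ℂ] (1 : Q))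

/-- The tensor product `U₁₃ V₂₃` in `B(H ⊗ K) ⊗ Q`. -/
def tensorU (U : Module.End ℂ H ⊗[ℂ] Q) (V : Module.End ℂ K ⊗[ℂ] Q) :
    Module.End ℂ (H ⊗[ℂ] K) ⊗[ℂ] Q :=
  (leg13 K U : Module.End ℂ (H ⊗[ℂ] K) ⊗[ℂ] Q) * leg23 H V

lemma tensorU_eq (U : Module.End ℂ H ⊗[ℂ] Q) (V : Module.End ℂ K ⊗[ℂ] Q) :
    tensorU U V = qmul (leg13 K U) (leg23 H V) := (qmul_eq_mul _ _).symm

namespace Intertwines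

lemma id (U : Module.End ℂ H ⊗[ℂ] Q) : Intertwines LinearMap.id U U := by
  rw [Intertwines, one_qmul, qmul_one]

lemma comp {T : H →ₗ[ℂ] H'} {S : H' →ₗ[ℂ] H''} {U : Module.End ℂ H ⊗[ℂ] Q}
    {V : Module.End ℂ H' ⊗[ℂ] Q} {W : Module.End ℂ H'' ⊗[ℂ] Q}
    (hT : Intertwines T U V) (hS : Intertwines S V W) : Intertwines (S ∘ₗ T) U W := by
  rw [Intertwines] at *
  have h : (S ∘ₗ T) ⊗ₜ[ℂ] (1 : Q) = qmul (S ⊗ₜ[ℂ] 1) (T ⊗ₜ[ℂ] 1) := by simp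
  rw [h, qmul_assoc, hT, ← qmul_assoc, hS, qmul_assoc]

lemma rTensor {T : H →ₗ[ℂ] H'} {U : Module.End ℂ H ⊗[ℂ] Q} {U' : Module.End ℂ H' ⊗[ℂ] Q}
    (hT : Intertwines T U U') (V : Module.End ℂ K ⊗[ℂ] Q) :
    Intertwines (LinearMap.rTensor K T) (tensorU U V) (tensorU U' V) := by
  rw [Intertwines] at *
  rw [tensorU_eq, tensorU_eq, ← leg13_tmul, ← qmul_assoc, ← leg13_qmul, hT, leg13_qmul,
    qmul_assoc, leg13_comm, qmul_assoc]

lemma lTensor {S : K →ₗ[ℂ] K'} {V : Module.End ℂ K ⊗[ℂ] Q} {V' : Module.End ℂ K' ⊗[ℂ] Q}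
    (U : Module.End ℂ H ⊗[ℂ] Q) (hS : Intertwines S V V') :
    Intertwines (LinearMap.lTensor H S) (tensorU U V) (tensorU U V') := by
  rw [Intertwines] at *
  rw [tensorU_eq, tensorU_eq, ← leg23_tmul, ← qmul_assoc, leg23_comm, qmul_assoc, ← leg23_qmul,
    hS, leg23_qmul, ← qmul_assoc]

lemma map {T : H →ₗ[ℂ] H'} {S : K →ₗ[ℂ] K'}
    {U : Module.End ℂ H ⊗[ℂ] Q} {U' : Module.End ℂ H' ⊗[ℂ] Q}
    {V : Module.End ℂ K ⊗[ℂ] Q} {V' : Module.End ℂ K' ⊗[ℂ] Q}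
    (hT : Intertwines T U U') (hS : Intertwines S V V') :
    Intertwines (TensorProduct.map T S) (tensorU U V) (tensorU U' V') := by
  rw [← LinearMap.lTensor_comp_rTensor]
  exact (hT.rTensor V).comp (hS.lTensor U')

lemma symm {e : H ≃ₗ[ℂ] H'} {U : Module.End ℂ H ⊗[ℂ] Q} {V : Module.End ℂ H' ⊗[ℂ] Q}
    (h : Intertwines e.toLinearMap U V) : Intertwines e.symm.toLinearMap V U := by
  rw [Intertwines] at *
  have h1 : qmul (e.symm.toLinearMap ⊗ₜ[ℂ] (1 : Q)) (e.toLinearMap ⊗ₜ[ℂ] (1 : Q))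
      = LinearMap.id ⊗ₜ[ℂ] (1 : Q) := by simp
  have h2 : qmul (e.toLinearMap ⊗ₜ[ℂ] (1 : Q)) (e.symm.toLinearMap ⊗ₜ[ℂ] (1 : Q))
      = LinearMap.id ⊗ₜ[ℂ] (1 : Q) := by simp
  calc qmul (e.symm.toLinearMap ⊗ₜ[ℂ] (1 : Q)) V
      = qmul (e.symm.toLinearMap ⊗ₜ[ℂ] (1 : Q)) (qmul (qmul V (e.toLinearMap ⊗ₜ[ℂ] (1 : Q)))
          (e.symm.toLinearMap ⊗ₜ[ℂ] (1 : Q))) := by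
        rw [qmul_assoc, h2, qmul_one]
    _ = qmul U (e.symm.toLinearMap ⊗ₜ[ℂ] (1 : Q)) := by
        rw [← h, qmul_assoc, ← qmul_assoc, h1, one_qmul]

end Intertwines

lemma assoc_intertwines
    (x : Module.End ℂ H ⊗[ℂ] Q) (y : Module.End ℂ K ⊗[ℂ] Q) (z : Module.End ℂ L ⊗[ℂ] Q) :
    qmul ((TensorProduct.assoc ℂ H K L).toLinearMap ⊗ₜ[ℂ] (1 : Q))
        (qmul (leg13 L (qmul (leg13 K x) (leg23 H y))) (leg23 (H ⊗[ℂ] K) z))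
      = qmul (qmul (leg13 (K ⊗[ℂ] L) x) (leg23 H (qmul (leg13 L y) (leg23 K z))))
        ((TensorProduct.assoc ℂ H K L).toLinearMap ⊗ₜ[ℂ] (1 : Q)) := by
  induction x using TensorProduct.induction_on with
  | zero => simp
  | add x₁ x₂ h₁ h₂ => simp only [map_add, LinearMap.add_apply, h₁, h₂]
  | tmul R a =>
    induction y using TensorProduct.induction_on with
    | zero => simp
    | add x₁ x₂ h₁ h₂ => simp only [map_add, LinearMap.add_apply, h₁, h₂]
    | tmul S b =>
      induction z using TensorProduct.induction_on with
      | zero => simp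
      | add x₁ x₂ h₁ h₂ => simp only [map_add, LinearMap.add_apply, h₁, h₂]
      | tmul T c =>
        simp only [leg13_tmul, leg23_tmul, qmul_tmul, one_mul, mul_one, mul_assoc]
        congr 1
        ext u v w
        rfl

lemma lid_intertwines
    (x : Module.End ℂ H ⊗[ℂ] Q) :
    qmul ((TensorProduct.lid ℂ H).toLinearMap ⊗ₜ[ℂ] (1 : Q))
        (qmul (leg13 H ((LinearMap.id : ℂ →ₗ[ℂ] ℂ) ⊗ₜ[ℂ] (1 : Q))) (leg23 ℂ x))
      = qmul x ((TensorProduct.lid ℂ H).toLinearMap ⊗ₜ[ℂ] (1 : Q)) := by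
  induction x using TensorProduct.induction_on with
  | zero => simp
  | add x₁ x₂ h₁ h₂ => simp only [map_add, LinearMap.add_apply, h₁, h₂]
  | tmul R a =>
    simp only [leg13_tmul, leg23_tmul, qmul_tmul, one_mul, mul_one]
    congr 1
    ext u
    simp

lemma rid_intertwines
    (x : Module.End ℂ H ⊗[ℂ] Q) :
    qmul ((TensorProduct.rid ℂ H).toLinearMap ⊗ₜ[ℂ] (1 : Q))
        (qmul (leg13 ℂ x) (leg23 H ((LinearMap.id : ℂ →ₗ[ℂ] ℂ) ⊗ₜ[ℂ] (1 : Q))))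
      = qmul x ((TensorProduct.rid ℂ H).toLinearMap ⊗ₜ[ℂ] (1 : Q)) := by
  induction x using TensorProduct.induction_on with
  | zero => simp
  | add x₁ x₂ h₁ h₂ => simp only [map_add, LinearMap.add_apply, h₁, h₂]
  | tmul R a =>
    simp only [leg13_tmul, leg23_tmul, qmul_tmul, one_mul, mul_one]
    congr 1
    ext u
    simp

lemma Intertwines.assoc (x : Module.End ℂ H ⊗[ℂ] Q) (y : Module.End ℂ K ⊗[ℂ] Q)
    (z : Module.End ℂ L ⊗[ℂ] Q) :
    Intertwines (TensorProduct.assoc ℂ H K L).toLinearMap (tensorU (tensorU x y) z)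
      (tensorU x (tensorU y z)) := by
  rw [Intertwines, tensorU_eq, tensorU_eq, tensorU_eq, tensorU_eq]
  exact assoc_intertwines x y z

lemma Intertwines.lid (x : Module.End ℂ H ⊗[ℂ] Q) :
    Intertwines (TensorProduct.lid ℂ H).toLinearMap (tensorU (1 : Module.End ℂ ℂ ⊗[ℂ] Q) x) x := by
  rw [Intertwines, tensorU_eq]
  exact lid_intertwines x

lemma Intertwines.rid (x : Module.End ℂ H ⊗[ℂ] Q) :
    Intertwines (TensorProduct.rid ℂ H).toLinearMap (tensorU x (1 : Module.End ℂ ℂ ⊗[ℂ] Q)) x := by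
  rw [Intertwines, tensorU_eq]
  exact rid_intertwines x

end Algebraic

variable {H H' H'' K : Type}
  [NormedAddCommGroup H] [InnerProductSpace ℂ H] [FiniteDimensional ℂ H]
  [NormedAddCommGroup H'] [InnerProductSpace ℂ H'] [FiniteDimensional ℂ H']
  [NormedAddCommGroup H''] [InnerProductSpace ℂ H''] [FiniteDimensional ℂ H'']
  [NormedAddCommGroup K] [InnerProductSpace ℂ K] [FiniteDimensional ℂ K]

/-- The adjoint `(T ⊗ a)* = T* ⊗ a*`. -/
def qadj : ((H →ₗ[ℂ] H') ⊗[ℂ] Q) →ₛₗ[starRingEnd ℂ] ((H' →ₗ[ℂ] H) ⊗[ℂ] Q) :=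
  TensorProduct.map (LinearMap.adjoint (𝕜 := ℂ) (E := H) (F := H')).toLinearMap
    (starLinearEquiv ℂ (A := Q)).toLinearMap

@[simp] lemma qadj_tmul (T : H →ₗ[ℂ] H') (a : Q) :
    qadj (T ⊗ₜ[ℂ] a) = (LinearMap.adjoint T) ⊗ₜ[ℂ] (star a) := rfl

lemma qadj_eq_star (x : Module.End ℂ H ⊗[ℂ] Q) : qadj x = star x := by
  induction x using TensorProduct.induction_on with
  | zero => simp
  | add x₁ x₂ h₁ h₂ => simp [h₁, h₂]
  | tmul S a => rfl

lemma qadj_qmul (x : (H' →ₗ[ℂ] H'') ⊗[ℂ] Q) (y : (H →ₗ[ℂ] H') ⊗[ℂ] Q) :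
    qadj (qmul x y) = qmul (qadj y) (qadj x) := by
  induction x using TensorProduct.induction_on with
  | zero => simp
  | add x₁ x₂ h₁ h₂ => simp [h₁, h₂]
  | tmul S a =>
    induction y using TensorProduct.induction_on with
    | zero => simp
    | add x₁ x₂ h₁ h₂ => simp [h₁, h₂]
    | tmul T b => simp [LinearMap.adjoint_comp]

lemma qadj_leg13 (x : (H →ₗ[ℂ] H') ⊗[ℂ] Q) : qadj (leg13 K x) = leg13 K (qadj x) := by
  induction x using TensorProduct.induction_on with
  | zero => simp only [map_zero]
  | add x₁ x₂ h₁ h₂ => simp only [map_add, h₁, h₂]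
  | tmul S a => rw [leg13_tmul, qadj_tmul, qadj_tmul, leg13_tmul, LinearMap.adjoint_rTensor]

lemma qadj_leg23 (x : (H →ₗ[ℂ] H') ⊗[ℂ] Q) : qadj (leg23 K x) = leg23 K (qadj x) := by
  induction x using TensorProduct.induction_on with
  | zero => simp only [map_zero]
  | add x₁ x₂ h₁ h₂ => simp only [map_add, h₁, h₂]
  | tmul S a => rw [leg23_tmul, qadj_tmul, qadj_tmul, leg23_tmul, LinearMap.adjoint_lTensor]

lemma leg13_star (x : Module.End ℂ H ⊗[ℂ] Q) :
    star (leg13 K x : Module.End ℂ (H ⊗[ℂ] K) ⊗[ℂ] Q) = leg13 K (star x) := by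
  rw [← qadj_eq_star, ← qadj_eq_star]
  exact qadj_leg13 x

lemma leg23_star (x : Module.End ℂ K ⊗[ℂ] Q) :
    star (leg23 H x : Module.End ℂ (H ⊗[ℂ] K) ⊗[ℂ] Q) = leg23 H (star x) := by
  rw [← qadj_eq_star, ← qadj_eq_star]
  exact qadj_leg23 x

lemma leg13_mem_unitary (U : unitary (Module.End ℂ H ⊗[ℂ] Q)) :
    (leg13 K U.1 : Module.End ℂ (H ⊗[ℂ] K) ⊗[ℂ] Q) ∈ unitary _ := by
  rw [Unitary.mem_iff, leg13_star, ← qmul_eq_mul, ← qmul_eq_mul, ← leg13_qmul, ← leg13_qmul,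
    qmul_eq_mul, qmul_eq_mul, (Unitary.mem_iff.1 U.2).1, (Unitary.mem_iff.1 U.2).2, leg13_one]
  exact ⟨rfl, rfl⟩

lemma leg23_mem_unitary (U : unitary (Module.End ℂ K ⊗[ℂ] Q)) :
    (leg23 H U.1 : Module.End ℂ (H ⊗[ℂ] K) ⊗[ℂ] Q) ∈ unitary _ := by
  rw [Unitary.mem_iff, leg23_star, ← qmul_eq_mul, ← qmul_eq_mul, ← leg23_qmul, ← leg23_qmul,
    qmul_eq_mul, qmul_eq_mul, (Unitary.mem_iff.1 U.2).1, (Unitary.mem_iff.1 U.2).2, leg23_one]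
  exact ⟨rfl, rfl⟩

lemma tensorU_mem_unitary (U : unitary (Module.End ℂ H ⊗[ℂ] Q))
    (V : unitary (Module.End ℂ K ⊗[ℂ] Q)) : tensorU U.1 V.1 ∈ unitary _ :=
  mul_mem (leg13_mem_unitary U) (leg23_mem_unitary V)

lemma Intertwines.adjoint {T : H →ₗ[ℂ] H'} {U : unitary (Module.End ℂ H ⊗[ℂ] Q)}
    {V : unitary (Module.End ℂ H' ⊗[ℂ] Q)} (hT : Intertwines T U.1 V.1) :
    Intertwines (LinearMap.adjoint T) V.1 U.1 := by
  rw [Intertwines] at *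
  have h := congrArg qadj hT
  rw [qadj_qmul, qadj_qmul, qadj_tmul, star_one, qadj_eq_star, qadj_eq_star] at h
  have hX : qmul U.1 (star U.1) = (LinearMap.id : H →ₗ[ℂ] H) ⊗ₜ[ℂ] (1 : Q) := by
    rw [qmul_eq_mul, (Unitary.mem_iff.1 U.2).2]; rfl
  have hY : qmul (star V.1) V.1 = (LinearMap.id : H' →ₗ[ℂ] H') ⊗ₜ[ℂ] (1 : Q) := by
    rw [qmul_eq_mul, (Unitary.mem_iff.1 V.2).1]; rfl
  calc qmul (LinearMap.adjoint T ⊗ₜ[ℂ] (1 : Q)) V.1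
      = qmul U.1 (qmul (qmul (star U.1) (LinearMap.adjoint T ⊗ₜ[ℂ] (1 : Q))) V.1) := by
        rw [← qmul_assoc, ← qmul_assoc, hX, one_qmul]
    _ = qmul U.1 (LinearMap.adjoint T ⊗ₜ[ℂ] (1 : Q)) := by
        rw [h, qmul_assoc, hY, qmul_one]

end QOperators

/-! ### The tensor category of all pairs `(U, H)` with `U ∈ B(H) ⊗ Q` unitary -/

/-- A pair `(U, H)`: a finite-dimensional Hilbert space `H` and a unitary `U ∈ B(H) ⊗ Q`. -/
structure UnitaryPair (Q : Type*) [CStarAlgebra Q] where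
  /-- the Hilbert space -/
  H : Type
  [normed : NormedAddCommGroup H]
  [inner : InnerProductSpace ℂ H]
  [finDim : FiniteDimensional ℂ H]
  /-- the unitary -/
  U : unitary (Module.End ℂ H ⊗[ℂ] Q)

attribute [instance] UnitaryPair.normed UnitaryPair.inner UnitaryPair.finDim

variable {Q : Type*} [CStarAlgebra Q]

/-- The intertwiners `T : H → K` with `(T ⊗ 1) U = V (T ⊗ 1)`. -/
def Mor (X Y : UnitaryPair Q) : Submodule ℂ (X.H →ₗ[ℂ] Y.H) where
  carrier := {T | Intertwines T X.U.1 Y.U.1}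
  zero_mem' := by simp [Intertwines]
  add_mem' {S T} hS hT := by
    change qmul _ _ = _ at hS hT
    change qmul _ _ = _
    rw [TensorProduct.add_tmul, map_add, map_add, LinearMap.add_apply, hS, hT]
  smul_mem' z T hT := by
    change qmul _ _ = _ at hT
    change qmul _ _ = _
    rw [← TensorProduct.smul_tmul', map_smul, map_smul, LinearMap.smul_apply, hT]

instance : Category (UnitaryPair Q) where
  Hom X Y := Mor X Y
  id X := ⟨LinearMap.id, Intertwines.id X.U.1⟩
  comp T S := ⟨S.1 ∘ₗ T.1, Intertwines.comp T.2 S.2⟩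

/-- The linear operator underlying an intertwiner. -/
def op {X Y : UnitaryPair Q} (T : X ⟶ Y) : X.H →ₗ[ℂ] Y.H := T.1

/-- An operator that intertwines, as a morphism. -/
def mkHom {X Y : UnitaryPair Q} (T : X.H →ₗ[ℂ] Y.H) (hT : Intertwines T X.U.1 Y.U.1) :
    X ⟶ Y := ⟨T, hT⟩

@[simp] lemma op_mkHom {X Y : UnitaryPair Q} (T : X.H →ₗ[ℂ] Y.H)
    (hT : Intertwines T X.U.1 Y.U.1) : op (mkHom T hT) = T := rfl

@[simp] lemma op_id (X : UnitaryPair Q) : op (𝟙 X) = LinearMap.id := rfl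

@[simp] lemma op_comp {X Y Z : UnitaryPair Q} (T : X ⟶ Y) (S : Y ⟶ Z) :
    op (T ≫ S) = op S ∘ₗ op T := rfl

lemma op_mem {X Y : UnitaryPair Q} (T : X ⟶ Y) : Intertwines (op T) X.U.1 Y.U.1 := T.2

lemma op_injective {X Y : UnitaryPair Q} {S T : X ⟶ Y} (h : op S = op T) : S = T := Subtype.ext h

instance : Preadditive (UnitaryPair Q) where
  homGroup X Y := inferInstanceAs (AddCommGroup (Mor X Y))
  add_comp _ _ _ _ _ S := Subtype.ext (LinearMap.comp_add _ _ S.1)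
  comp_add _ _ _ T _ _ := Subtype.ext (LinearMap.add_comp T.1 _ _)

instance : Linear ℂ (UnitaryPair Q) where
  homModule X Y := inferInstanceAs (Module ℂ (Mor X Y))
  smul_comp _ _ _ z T S := Subtype.ext (LinearMap.comp_smul S.1 z T.1)
  comp_smul _ _ _ T z S := Subtype.ext (LinearMap.smul_comp z S.1 T.1)

/-- The Hilbert space adjoint and the operator norm. -/
instance : HasDagNorm (UnitaryPair Q) where
  dag T := mkHom (LinearMap.adjoint (op T)) (op_mem T).adjoint
  mnorm T := ‖LinearMap.toContinuousLinearMap (op T)‖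

/-- The tensor product `(U, H) ⊗ (V, K) = (U₁₃ V₂₃, H ⊗ K)`. -/
abbrev tensorPair (X Y : UnitaryPair Q) : UnitaryPair Q where
  H := X.H ⊗[ℂ] Y.H
  U := ⟨tensorU X.U.1 Y.U.1, tensorU_mem_unitary X.U Y.U⟩

/-- The unit object `(1, ℂ)`. -/
abbrev unitPair : UnitaryPair Q where
  H := ℂ
  U := 1

/-- A bijective intertwiner as an isomorphism. -/
def mkIso {X Y : UnitaryPair Q} (e : X.H ≃ₗ[ℂ] Y.H) (h : Intertwines e.toLinearMap X.U.1 Y.U.1) :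
    X ≅ Y where
  hom := mkHom e.toLinearMap h
  inv := mkHom e.symm.toLinearMap h.symm
  hom_inv_id := op_injective (by simp)
  inv_hom_id := op_injective (by simp)

set_option linter.unusedVariables false

/-- On objects `(U, H) ⊗ (V, K) = (U₁₃ V₂₃, H ⊗ K)`, on morphisms the tensor product of operators;
the associativity and unit constraints are the canonical identifications
`(H ⊗ K) ⊗ L = H ⊗ (K ⊗ L)` and `ℂ ⊗ H = H = H ⊗ ℂ` of Hilbert spaces. -/
instance : MonoidalCategoryStruct (UnitaryPair Q) where
  tensorObj := tensorPair
  whiskerLeft X _ _ S := mkHom (LinearMap.lTensor X.H (op S)) ((op_mem S).lTensor X.U.1)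
  whiskerRight T Y := mkHom (LinearMap.rTensor Y.H (op T)) ((op_mem T).rTensor Y.U.1)
  tensorHom T S := mkHom (TensorProduct.map (op T) (op S)) ((op_mem T).map (op_mem S))
  tensorUnit := unitPair
  associator X Y Z := mkIso (TensorProduct.assoc ℂ X.H Y.H Z.H) (.assoc X.U.1 Y.U.1 Z.U.1)
  leftUnitor X := mkIso (TensorProduct.lid ℂ X.H) (.lid X.U.1)
  rightUnitor X := mkIso (TensorProduct.rid ℂ X.H) (.rid X.U.1)

instance : MonoidalCategory (UnitaryPair Q) where
  tensorHom_def T S := op_injective (LinearMap.lTensor_comp_rTensor _ _ _).symm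
  id_tensorHom_id X Y := op_injective TensorProduct.map_id
  tensorHom_comp_tensorHom T₁ T₂ S₁ S₂ := op_injective (TensorProduct.map_comp _ _ _ _).symm
  whiskerLeft_id X Y := op_injective (LinearMap.lTensor_id _ _)
  id_whiskerRight X Y := op_injective (LinearMap.rTensor_id _ _)
  associator_naturality T₁ T₂ T₃ := op_injective (TensorProduct.ext_threefold fun _ _ _ => rfl)
  leftUnitor_naturality T := op_injective (TensorProduct.ext' fun (z : ℂ) x =>
    ((op T).map_smul z x).symm)
  rightUnitor_naturality T := op_injective
    (TensorProduct.ext' fun x (z : ℂ) => ((op T).map_smul z x).symm)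
  pentagon W X Y Z := op_injective (TensorProduct.ext_fourfold fun _ _ _ _ => rfl)
  triangle X Y := op_injective (TensorProduct.ext_threefold fun x (z : ℂ) y =>
    (TensorProduct.smul_tmul z x y).symm)

/-! ### The category `α` -/

/-- The pair `(Ū, H̄)` on the conjugate Hilbert space given by a unitary `Ū ∈ B(H̄) ⊗ Q`. -/
abbrev conjPair (X : UnitaryPair Q) (Ubar : unitary (Module.End ℂ (ConjSpace X.H) ⊗[ℂ] Q)) :
    UnitaryPair Q where
  H := ConjSpace X.H
  U := Ubar

/-- The condition defining the objects of `α`: there are a unitary `Ū ∈ B(H̄) ⊗ Q` and intertwiners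
`R_s : ℂ → H̄ ⊗ H`, `R_t : ℂ → H ⊗ H̄` (from `(1, ℂ)` to `Ū ⊗ U`, `U ⊗ Ū`) that solve the
conjugate equations. -/
def hasConj (Q : Type*) [CStarAlgebra Q] : ObjectProperty (UnitaryPair Q) := fun X =>
  ∃ (Ubar : unitary (Module.End ℂ (ConjSpace X.H) ⊗[ℂ] Q))
    (Rs : 𝟙_ (UnitaryPair Q) ⟶ conjPair X Ubar ⊗ X)
    (Rt : 𝟙_ (UnitaryPair Q) ⟶ X ⊗ conjPair X Ubar), SolvesConjugateEquations Rs Rt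

/-- The category `α`: all pairs `(U, H)` satisfying `hasConj`, with all intertwiners. -/
abbrev Alpha (Q : Type*) [CStarAlgebra Q] : Type _ := (hasConj Q).FullSubcategory

end AlphaCat

end

noncomputable section

namespace AlphaCat

open HasDagNorm

/-! ### The C*-category of unitary pairs -/

section CStar

variable {Q : Type*} [CStarAlgebra Q]

/-! All unitary pairs already form a C*-tensor category. Morphism spaces are finite-dimensional
spaces of operators, stable under adjoints because the `U`'s are unitary, so norm and adjoint have
the properties they have for operators. Direct sums carry the block diagonal unitary. Subobjects
exist because `U` restricts to the range of any idempotent intertwiner (`exists_splitting`).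

Rigidity is reduced to duality in a monoidal category. With `R'` as coevaluation and `R*` as
evaluation, one conjugate equation is a zigzag identity and the other is the adjoint of the second
zigzag identity (`isConjugate_iff_exactPairing`). A dual of `(U, H)` may live on any Hilbert space,
but the conjugate equations force its dimension to be that of `H`, so it can be moved onto `H̄` by a
unitary (`hasConj_iff`). Hence `α` consists exactly of the dualizable pairs
(`hasConj_iff_dualizable`).

Dualizable objects include the unit and are closed under tensor products, under retracts (split the
transposed idempotent on the dual) and under direct sums (add the duals). Exchanging `R` and `R'`
shows that a conjugate of an object of `α` is again in `α`. The remaining axioms pass to the full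
subcategory. -/

@[simp] lemma op_dag {X Y : UnitaryPair Q} (T : X ⟶ Y) :
    op (dag T) = LinearMap.adjoint (op T) := rfl

lemma mnorm_def {X Y : UnitaryPair Q} (T : X ⟶ Y) :
    mnorm T = ‖LinearMap.toContinuousLinearMap (op T)‖ := rfl

@[simp] lemma op_add {X Y : UnitaryPair Q} (S T : X ⟶ Y) : op (S + T) = op S + op T := rfl

@[simp] lemma op_sub {X Y : UnitaryPair Q} (S T : X ⟶ Y) : op (S - T) = op S - op T := rfl

@[simp] lemma op_smul {X Y : UnitaryPair Q} (z : ℂ) (T : X ⟶ Y) : op (z • T) = z • op T := rfl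

lemma Intertwines.add {X Y : UnitaryPair Q} {S T : X.H →ₗ[ℂ] Y.H}
    (hS : Intertwines S X.U.1 Y.U.1) (hT : Intertwines T X.U.1 Y.U.1) :
    Intertwines (S + T) X.U.1 Y.U.1 := (Mor X Y).add_mem hS hT

lemma Intertwines.smul {X Y : UnitaryPair Q} {T : X.H →ₗ[ℂ] Y.H} (z : ℂ)
    (hT : Intertwines T X.U.1 Y.U.1) : Intertwines (z • T) X.U.1 Y.U.1 :=
  (Mor X Y).smul_mem z hT

/-- Keeps the square root of `T* T` inside the category: it is found as a polynomial in `T* T`. -/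
lemma Intertwines.aeval {X : UnitaryPair Q} {T : Module.End ℂ X.H}
    (hT : Intertwines T X.U.1 X.U.1) (p : Polynomial ℂ) :
    Intertwines (Polynomial.aeval T p) X.U.1 X.U.1 := by
  have hpow (n : ℕ) : Intertwines (T ^ n) X.U.1 X.U.1 := by
    induction n with
    | zero => exact Intertwines.id _
    | succ n ih => rw [pow_succ]; exact hT.comp ih
  induction p using Polynomial.induction_on' with
  | add p q hp hq => rw [map_add]; exact hp.add hq
  | monomial n a =>
    rw [Polynomial.aeval_monomial, ← Algebra.smul_def]
    exact (hpow n).smul a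

/-- A positive operator on a finite-dimensional Hilbert space has a self-adjoint square root that
is a polynomial in it. -/
lemma exists_polynomial_sqrt {H : Type*} [NormedAddCommGroup H] [InnerProductSpace ℂ H]
    [FiniteDimensional ℂ H] {A : H →ₗ[ℂ] H} (hA : A.IsPositive) :
    ∃ p : Polynomial ℂ, LinearMap.adjoint (Polynomial.aeval A p) ∘ₗ Polynomial.aeval A p = A := by
  classical
  have hs := hA.isSymmetric
  set b := hs.eigenvectorBasis rfl
  set μ := hs.eigenvalues rfl
  have hμ (i) : 0 ≤ μ i := hA.nonneg_eigenvalues rfl i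
  let s : Finset ℂ := Finset.univ.image fun i => (μ i : ℂ)
  -- Interpolating the square root on the finite set of eigenvalues makes `p(A)` act on the
  -- eigenbasis by `√μ i`. Passing to a `Finset` removes repeated eigenvalues, so the nodes are
  -- distinct.
  let p := Lagrange.interpolate s id fun z => ((Real.sqrt z.re : ℝ) : ℂ)
  have hp (i) : p.eval (μ i : ℂ) = (Real.sqrt (μ i) : ℂ) := by
    have h := Lagrange.eval_interpolate_at_node (s := s) (v := id)
      (fun z => ((Real.sqrt z.re : ℝ) : ℂ)) (Set.injOn_id _)
      (Finset.mem_image_of_mem (fun i => (μ i : ℂ)) (Finset.mem_univ i))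
    simpa only [id_eq, Complex.ofReal_re] using h
  have hb (i) : Polynomial.aeval A p (b i) = (Real.sqrt (μ i) : ℂ) • b i := by
    have h : A (b i) = (μ i : ℂ) • b i := hs.apply_eigenvectorBasis rfl i
    rw [← hp i]
    exact Module.End.aeval_apply_of_hasEigenvector
      ⟨Module.End.mem_eigenspace_iff.2 h, b.orthonormal.ne_zero i⟩
  -- Diagonal with real entries in an orthonormal basis.
  have hadj : LinearMap.adjoint (Polynomial.aeval A p) = Polynomial.aeval A p := by
    refine ((LinearMap.eq_adjoint_iff_basis b.toBasis b.toBasis _ _).2 fun i j => ?_).symm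
    simp only [OrthonormalBasis.coe_toBasis]
    rw [hb, hb, inner_smul_left, inner_smul_right, Complex.conj_ofReal, b.inner_eq_ite]
    split_ifs with h
    · rw [h]
    · simp
  refine ⟨p, ?_⟩
  rw [hadj]
  refine b.toBasis.ext fun i => ?_
  have h : A (b i) = (μ i : ℂ) • b i := hs.apply_eigenvectorBasis rfl i
  rw [OrthonormalBasis.coe_toBasis, LinearMap.comp_apply, hb, map_smul, hb, h, smul_smul,
    ← Complex.ofReal_mul, Real.mul_self_sqrt (hμ i)]

lemma exists_dag_comp_self_eq {X Y : UnitaryPair Q} (T : X ⟶ Y) :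
    ∃ S : X ⟶ X, T ≫ dag T = S ≫ dag S := by
  obtain ⟨p, hp⟩ := exists_polynomial_sqrt (LinearMap.isPositive_adjoint_comp_self (op T))
  exact ⟨mkHom _ (Intertwines.aeval (op_mem (T ≫ dag T)) p), op_injective hp.symm⟩

/-- The intertwiners form a finite-dimensional, hence complete, subspace of the bounded operators,
so a limit of intertwiners is one too; no topology on `B(H, K) ⊗ Q` is needed. -/
lemma mnorm_complete {X Y : UnitaryPair Q} (u : ℕ → (X ⟶ Y))
    (hu : ∀ ε > 0, ∃ N, ∀ m ≥ N, ∀ n ≥ N, mnorm (u m - u n) < ε) :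
    ∃ T : X ⟶ Y, ∀ ε > 0, ∃ N, ∀ n ≥ N, mnorm (u n - T) < ε := by
  let M : Submodule ℂ (X.H →L[ℂ] Y.H) :=
    (Mor X Y).map (LinearMap.toContinuousLinearMap (𝕜 := ℂ) (E := X.H) (F' := Y.H)).toLinearMap
  let f (n : ℕ) : X.H →L[ℂ] Y.H := LinearMap.toContinuousLinearMap (op (u n))
  have hsub (S T : X ⟶ Y) : mnorm (S - T) = dist (LinearMap.toContinuousLinearMap (op S))
      (LinearMap.toContinuousLinearMap (op T)) := by
    rw [dist_eq_norm, mnorm_def, op_sub, map_sub]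
  have hf : CauchySeq f := Metric.cauchySeq_iff.2 fun ε hε => by
    simpa only [hsub] using hu ε hε
  obtain ⟨g, ⟨T, hT, rfl⟩, hg⟩ := cauchySeq_tendsto_of_isComplete
    (K := (M : Set (X.H →L[ℂ] Y.H))) M.complete_of_finiteDimensional
    (fun n => ⟨op (u n), op_mem (u n), rfl⟩) hf
  refine ⟨mkHom T hT, ?_⟩
  simp only [hsub]
  exact Metric.tendsto_atTop.1 hg

theorem isCStarCategory_unitaryPair : IsCStarCategory (UnitaryPair Q) where
  mnorm_eq_zero_iff T := by
    rw [mnorm_def, norm_eq_zero, LinearEquiv.map_eq_zero_iff]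
    exact ⟨fun h => op_injective h, fun h => h ▸ rfl⟩
  mnorm_add_le S T := by
    simpa only [mnorm_def, op_add, map_add] using norm_add_le _ _
  mnorm_smul z T := by
    simpa only [mnorm_def, op_smul, map_smul] using norm_smul _ _
  complete := mnorm_complete
  mnorm_comp_le T S := ContinuousLinearMap.opNorm_comp_le
    (LinearMap.toContinuousLinearMap (op S)) (LinearMap.toContinuousLinearMap (op T))
  dag_add S T := op_injective (by simp)
  dag_smul z T := op_injective (LinearMap.adjoint.map_smulₛₗ z (op T))
  dag_id X := op_injective (by simp)
  dag_comp T S := op_injective (by simp [LinearMap.adjoint_comp])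
  dag_dag T := op_injective (by simp)
  cstar T := by
    have h := ContinuousLinearMap.norm_adjoint_comp_self (LinearMap.toContinuousLinearMap (op T))
    rw [← LinearMap.adjoint_toContinuousLinearMap, ← sq] at h
    exact h
  positive := exists_dag_comp_self_eq

end CStar

/-! ### Subobjects and direct sums of unitary pairs -/

section SubobjectsAndSums

variable {Q : Type*} [CStarAlgebra Q]
variable {H H' K : Type}
  [NormedAddCommGroup H] [InnerProductSpace ℂ H] [FiniteDimensional ℂ H]
  [NormedAddCommGroup H'] [InnerProductSpace ℂ H'] [FiniteDimensional ℂ H']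
  [NormedAddCommGroup K] [InnerProductSpace ℂ K] [FiniteDimensional ℂ K]

/-- `qmul` and `qadj` also accept operators between different spaces, so in this form unitarity can
be checked by moving `v ⊗ 1` through products. -/
lemma mem_unitary_iff_qmul {W : Module.End ℂ H ⊗[ℂ] Q} :
    W ∈ unitary (Module.End ℂ H ⊗[ℂ] Q) ↔
      qmul (qadj W) W = (LinearMap.id : H →ₗ[ℂ] H) ⊗ₜ[ℂ] (1 : Q) ∧
      qmul W (qadj W) = (LinearMap.id : H →ₗ[ℂ] H) ⊗ₜ[ℂ] (1 : Q) := by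
  rw [Unitary.mem_iff, qadj_eq_star, qmul_eq_mul, qmul_eq_mul]
  rfl

/-- If `v` is an isometry and `v v*` commutes with the unitary `U`, then `U` restricts along `v` to
a unitary. -/
lemma exists_unitary_restrict (U : unitary (Module.End ℂ H ⊗[ℂ] Q)) (v : K →ₗ[ℂ] H)
    (hv : LinearMap.adjoint v ∘ₗ v = LinearMap.id)
    (hP : Intertwines (v ∘ₗ LinearMap.adjoint v) U.1 U.1) :
    ∃ W : unitary (Module.End ℂ K ⊗[ℂ] Q), Intertwines v W.1 U.1 := by
  obtain ⟨hU₁, hU₂⟩ := mem_unitary_iff_qmul.1 U.2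
  set a : (K →ₗ[ℂ] H) ⊗[ℂ] Q := v ⊗ₜ[ℂ] 1 with ha
  set b : (H →ₗ[ℂ] K) ⊗[ℂ] Q := LinearMap.adjoint v ⊗ₜ[ℂ] 1 with hb
  have hba : qmul b a = (LinearMap.id : K →ₗ[ℂ] K) ⊗ₜ[ℂ] (1 : Q) := by simp [ha, hb, hv]
  have hP' : qmul (qmul a b) U.1 = qmul U.1 (qmul a b) := by
    simpa [ha, hb, Intertwines] using hP
  have hbadj : qadj b = a := by simp [ha, hb]
  have haadj : qadj a = b := by simp [ha, hb]
  -- The adjoint of `hP'`: the self-adjoint `v v*` commutes with `U*` as well.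
  have hP'' : qmul (qadj U.1) (qmul a b) = qmul (qmul a b) (qadj U.1) := by
    have hab : qadj (qmul a b) = qmul a b := by rw [qadj_qmul, hbadj, haadj]
    have h := congrArg qadj hP'
    rwa [qadj_qmul (qmul a b), qadj_qmul U.1, hab] at h
  -- The compression `v* U v`. The commutation relations give `W v* = v* U` and `W* v* = v* U*`, so
  -- `W* W` and `W W*` both collapse to `v* v = 1`.
  set W : Module.End ℂ K ⊗[ℂ] Q := qmul b (qmul U.1 a) with hW
  have hWadj : qadj W = qmul b (qmul (qadj U.1) a) := by
    rw [hW, qadj_qmul, qadj_qmul, hbadj, haadj, qmul_assoc]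
  have haW : qmul a W = qmul U.1 a := by
    rw [hW, ← qmul_assoc, ← qmul_assoc, hP', qmul_assoc, qmul_assoc, hba, qmul_one]
  have hWb : qmul W b = qmul b U.1 := by
    rw [hW, qmul_assoc, qmul_assoc, ← hP', ← qmul_assoc, ← qmul_assoc, hba, one_qmul]
  have hWb' : qmul (qadj W) b = qmul b (qadj U.1) := by
    rw [hWadj, qmul_assoc, qmul_assoc, hP'', ← qmul_assoc, ← qmul_assoc, hba, one_qmul]
  refine ⟨⟨W, mem_unitary_iff_qmul.2 ⟨?_, ?_⟩⟩, haW⟩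
  · nth_rw 2 [hW]
    rw [← qmul_assoc, hWb', ← qmul_assoc, qmul_assoc b, hU₁, qmul_one, hba]
  · rw [hWadj, ← qmul_assoc, hWb, ← qmul_assoc, qmul_assoc b, hU₂, qmul_one, hba]

lemma adjoint_comp_self_of_isometry (v : K →ₗᵢ[ℂ] H) :
    LinearMap.adjoint v.toLinearMap ∘ₗ v.toLinearMap = LinearMap.id :=
  LinearMap.ext fun x => ext_inner_right ℂ fun y => by
    simp

/-- A projection with the same range as an idempotent commutes with every unitary that commutes
with the idempotent. -/
lemma star_projection_commute_unitary {R : Type*} [Monoid R] [StarMul R] {u q p : R}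
    (hu : u ∈ unitary R) (hq : q * u = u * q) (hp : star p = p) (hqp : q * p = p)
    (hpq : p * q = q) : p * u = u * p := by
  -- Anything commuting with `q` preserves its range, which is the range of `p`.
  have key {w : R} (hw : q * w = w * q) : w * p = p * (w * p) :=
    calc w * p = w * q * p := by rw [mul_assoc, hqp]
      _ = p * q * w * p := by rw [← hw, hpq]
      _ = p * (w * p) := by rw [mul_assoc p, hw, mul_assoc, mul_assoc, hqp]
  -- The adjoint of `hq` would speak of `star q`, and `q` need not be self-adjoint; unitarity of `u`
  -- is used instead.
  have hq' : q * star u = star u * q :=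
    calc q * star u = star u * (u * q) * star u := by
          rw [← mul_assoc, (Unitary.mem_iff.1 hu).1, one_mul]
      _ = star u * q := by
          rw [← hq, mul_assoc, mul_assoc, (Unitary.mem_iff.1 hu).2, mul_one]
  -- The adjoint of `u* p = p u* p` is `p u = p u p`, and `key hq` identifies the right side with `u
  -- p`.
  have h := congrArg star (key hq')
  rw [star_mul, star_mul, star_mul, star_star, hp, mul_assoc] at h
  rw [h, ← key hq]

/-- Idempotents split, along an isometry onto their range. -/
lemma exists_splitting {X : UnitaryPair Q} (q : X ⟶ X) (hq : q ≫ q = q) :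
    ∃ (Y : UnitaryPair Q) (v : Y ⟶ X), IsIsometry v ∧ v ≫ q = v ∧ q ≫ dag v ≫ v = q := by
  have hqq : op q ∘ₗ op q = op q := congrArg op hq
  -- Here `q` is not assumed self-adjoint, as the transpose of a projection need not be. The
  -- orthogonal projection `v v*` onto its range still commutes with `U`, so `U` restricts to that
  -- range.
  let v := (LinearMap.range (op q)).subtypeₗᵢ
  have hv := adjoint_comp_self_of_isometry v
  have hqv : op q ∘ₗ v.toLinearMap = v.toLinearMap := by
    ext ⟨_, x, rfl⟩
    exact LinearMap.congr_fun hqq x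
  have hpq : (v.toLinearMap ∘ₗ LinearMap.adjoint v.toLinearMap) ∘ₗ op q = op q := by
    ext x
    exact congrArg v (LinearMap.congr_fun hv ((op q).rangeRestrict x))
  have hP : Intertwines (v.toLinearMap ∘ₗ LinearMap.adjoint v.toLinearMap) X.U.1 X.U.1 := by
    have hqU := op_mem q
    rw [Intertwines, qmul_eq_mul, qmul_eq_mul] at hqU ⊢
    refine star_projection_commute_unitary X.U.2 hqU ?_ ?_ ?_
    · rw [← qadj_eq_star, qadj_tmul, star_one, LinearMap.adjoint_comp, LinearMap.adjoint_adjoint]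
    · rw [← qmul_eq_mul, qmul_tmul, mul_one, ← LinearMap.comp_assoc, hqv]
    · rw [← qmul_eq_mul, qmul_tmul, mul_one, hpq]
  obtain ⟨W, hW⟩ := exists_unitary_restrict X.U v.toLinearMap hv hP
  exact ⟨⟨LinearMap.range (op q), W⟩, mkHom v.toLinearMap hW, op_injective hv, op_injective hqv,
    op_injective hpq⟩

/-- The witness is the block diagonal `u U u* + v V v*`. Since `u* v = 0 = v* u`, cross terms vanish
and products are computed blockwise (`hprod`). -/
lemma exists_unitary_directSum (U : unitary (Module.End ℂ H ⊗[ℂ] Q))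
    (V : unitary (Module.End ℂ H' ⊗[ℂ] Q)) (u : H →ₗ[ℂ] K) (v : H' →ₗ[ℂ] K)
    (hu : LinearMap.adjoint u ∘ₗ u = LinearMap.id) (hv : LinearMap.adjoint v ∘ₗ v = LinearMap.id)
    (huv : LinearMap.adjoint u ∘ₗ v = 0) (hvu : LinearMap.adjoint v ∘ₗ u = 0)
    (hsum : u ∘ₗ LinearMap.adjoint u + v ∘ₗ LinearMap.adjoint v = LinearMap.id) :
    ∃ W : unitary (Module.End ℂ K ⊗[ℂ] Q), Intertwines u U.1 W.1 ∧ Intertwines v V.1 W.1 := by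
  obtain ⟨hU₁, hU₂⟩ := mem_unitary_iff_qmul.1 U.2
  obtain ⟨hV₁, hV₂⟩ := mem_unitary_iff_qmul.1 V.2
  set a : (H →ₗ[ℂ] K) ⊗[ℂ] Q := u ⊗ₜ[ℂ] 1 with ha
  set b : (K →ₗ[ℂ] H) ⊗[ℂ] Q := LinearMap.adjoint u ⊗ₜ[ℂ] 1 with hb
  set c : (H' →ₗ[ℂ] K) ⊗[ℂ] Q := v ⊗ₜ[ℂ] 1 with hc
  set d : (K →ₗ[ℂ] H') ⊗[ℂ] Q := LinearMap.adjoint v ⊗ₜ[ℂ] 1 with hd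
  have hba : qmul b a = (LinearMap.id : H →ₗ[ℂ] H) ⊗ₜ[ℂ] (1 : Q) := by simp [ha, hb, hu]
  have hdc : qmul d c = (LinearMap.id : H' →ₗ[ℂ] H') ⊗ₜ[ℂ] (1 : Q) := by simp [hc, hd, hv]
  have hbc : qmul b c = 0 := by simp [hb, hc, huv]
  have hda : qmul d a = 0 := by simp [ha, hd, hvu]
  have habcd : qmul a b + qmul c d = (LinearMap.id : K →ₗ[ℂ] K) ⊗ₜ[ℂ] (1 : Q) := by
    simp [ha, hb, hc, hd, ← TensorProduct.add_tmul, hsum]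
  have hprod (U₁ U₂ : Module.End ℂ H ⊗[ℂ] Q) (V₁ V₂ : Module.End ℂ H' ⊗[ℂ] Q) :
      qmul (qmul a (qmul U₁ b) + qmul c (qmul V₁ d)) (qmul a (qmul U₂ b) + qmul c (qmul V₂ d)) =
        qmul a (qmul (qmul U₁ U₂) b) + qmul c (qmul (qmul V₁ V₂) d) := by
    have h₁ (x : (K →ₗ[ℂ] H) ⊗[ℂ] Q) : qmul b (qmul a x) = x := by
      rw [← qmul_assoc, hba, one_qmul]
    have h₂ (x : (K →ₗ[ℂ] H') ⊗[ℂ] Q) : qmul d (qmul c x) = x := by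
      rw [← qmul_assoc, hdc, one_qmul]
    have h₃ (x : (K →ₗ[ℂ] H') ⊗[ℂ] Q) : qmul b (qmul c x) = 0 := by
      rw [← qmul_assoc, hbc, map_zero, LinearMap.zero_apply]
    have h₄ (x : (K →ₗ[ℂ] H) ⊗[ℂ] Q) : qmul d (qmul a x) = 0 := by
      rw [← qmul_assoc, hda, map_zero, LinearMap.zero_apply]
    simp only [map_add, LinearMap.add_apply, qmul_assoc, h₁, h₂, h₃, h₄, map_zero, add_zero,
      zero_add]
  set W : Module.End ℂ K ⊗[ℂ] Q := qmul a (qmul U.1 b) + qmul c (qmul V.1 d) with hW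
  have hWadj : qadj W = qmul a (qmul (qadj U.1) b) + qmul c (qmul (qadj V.1) d) := by
    simp [hW, qadj_qmul, ha, hb, hc, hd, qmul_assoc]
  refine ⟨⟨W, mem_unitary_iff_qmul.2 ⟨?_, ?_⟩⟩, ?_, ?_⟩
  · rw [hWadj, hprod, hU₁, hV₁, one_qmul, one_qmul, habcd]
  · rw [hWadj, hprod, hU₂, hV₂, one_qmul, one_qmul, habcd]
  · change qmul a U.1 = qmul W a
    simp only [hW, map_add, LinearMap.add_apply, qmul_assoc, hba, hda, map_zero, add_zero, qmul_one]
  · change qmul c V.1 = qmul W c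
    simp only [hW, map_add, LinearMap.add_apply, qmul_assoc, hbc, hdc, map_zero, zero_add, qmul_one]

lemma exists_directSum_unitaryPair (X Y : UnitaryPair Q) :
    ∃ (Z : UnitaryPair Q) (u : X ⟶ Z) (v : Y ⟶ Z),
      IsIsometry u ∧ IsIsometry v ∧ dag u ≫ u + dag v ≫ v = 𝟙 Z := by
  -- `WithLp 2` gives the product the Hilbert space norm; the adjoints of the inclusions are then
  -- the coordinate projections.
  let e := (WithLp.linearEquiv 2 ℂ (X.H × Y.H)).symm
  let u : X.H →ₗ[ℂ] WithLp 2 (X.H × Y.H) := e.toLinearMap ∘ₗ LinearMap.inl ℂ X.H Y.H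
  let v : Y.H →ₗ[ℂ] WithLp 2 (X.H × Y.H) := e.toLinearMap ∘ₗ LinearMap.inr ℂ X.H Y.H
  have hu : LinearMap.adjoint u = LinearMap.fst ℂ X.H Y.H ∘ₗ e.symm.toLinearMap :=
    ((LinearMap.eq_adjoint_iff _ _).2 fun x y => by
      simp [u, e, WithLp.prod_inner_apply]).symm
  have hv : LinearMap.adjoint v = LinearMap.snd ℂ X.H Y.H ∘ₗ e.symm.toLinearMap :=
    ((LinearMap.eq_adjoint_iff _ _).2 fun x y => by
      simp [v, e, WithLp.prod_inner_apply]).symm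
  have huu : LinearMap.adjoint u ∘ₗ u = LinearMap.id := by rw [hu]; rfl
  have hvv : LinearMap.adjoint v ∘ₗ v = LinearMap.id := by rw [hv]; rfl
  have hsum : u ∘ₗ LinearMap.adjoint u + v ∘ₗ LinearMap.adjoint v = LinearMap.id := by
    rw [hu, hv]
    refine LinearMap.ext fun x => e.symm.injective ?_
    ext <;> simp [u, v]
  obtain ⟨W, hWu, hWv⟩ := exists_unitary_directSum X.U Y.U u v huu hvv
    (by rw [hu]; rfl) (by rw [hv]; rfl) hsum
  exact ⟨⟨WithLp 2 (X.H × Y.H), W⟩, mkHom u hWu, mkHom v hWv, op_injective huu, op_injective hvv,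
    op_injective hsum⟩

/-! ### Unitarity of the constraints and the C*-tensor axioms. -/

lemma adjoint_linearIsometryEquiv (e : H ≃ₗᵢ[ℂ] K) :
    LinearMap.adjoint e.toLinearEquiv.toLinearMap = e.symm.toLinearEquiv.toLinearMap :=
  ((LinearMap.eq_adjoint_iff _ _).2 fun x y => by
    simpa using (e.inner_map_map (e.symm x) y).symm).symm

lemma isUnitaryMor_of_linearIsometryEquiv {X Y : UnitaryPair Q} {T : X ⟶ Y} (e : X.H ≃ₗᵢ[ℂ] Y.H)
    (h : op T = e.toLinearEquiv.toLinearMap) : IsUnitaryMor T := by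
  constructor <;> refine op_injective ?_ <;> ext x <;> simp [h, adjoint_linearIsometryEquiv]

theorem isCStarTensorCategory_unitaryPair : IsCStarTensorCategory (UnitaryPair Q) where
  toIsCStarCategory := isCStarCategory_unitaryPair
  add_tensor S T R := op_injective (TensorProduct.map_add_left (op S) (op T) (op R))
  tensor_add R S T := op_injective (TensorProduct.map_add_right (op R) (op S) (op T))
  smul_tensor z S T := op_injective (TensorProduct.map_smul_left z (op S) (op T))
  tensor_smul z S T := op_injective (TensorProduct.map_smul_right z (op S) (op T))
  dag_tensor S T := op_injective (TensorProduct.adjoint_map (op S) (op T))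
  associator_unitary X Y Z :=
    isUnitaryMor_of_linearIsometryEquiv (TensorProduct.assocIsometry ℂ X.H Y.H Z.H) rfl
  leftUnitor_unitary X :=
    isUnitaryMor_of_linearIsometryEquiv (TensorProduct.lidIsometry ℂ X.H) rfl
  rightUnitor_unitary X :=
    isUnitaryMor_of_linearIsometryEquiv (TensorProduct.ridIsometry ℂ X.H) rfl
  exists_directSum := exists_directSum_unitaryPair
  exists_subobject X p hp hpp := by
    obtain ⟨Y, v, hv, hvp, hpv⟩ := exists_splitting p hpp
    refine ⟨Y, v, hv, ?_⟩
    -- As operators, `v v* p = p` has adjoint `p v v* = p`, and `p v = v` turns the left side into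
    -- `v v*`.
    have h := congrArg dag hpv
    have hC := isCStarCategory_unitaryPair (Q := Q)
    simp only [hC.dag_comp, hp, hC.dag_dag, Category.assoc, hvp] at h
    exact h
  id_unit_ne_zero h := by
    exact one_ne_zero (α := ℂ) (LinearMap.congr_fun (congrArg op h) (1 : ℂ))
  end_unit T := ⟨op T (1 : ℂ), op_injective (LinearMap.ext_ring (by simp))⟩

end SubobjectsAndSums

/-! ### Duality in monoidal categories -/

section Duality

variable {C : Type*} [Category C] [MonoidalCategory C]

/-- By the interchange law `h` and `g` slide to the two ends, and inside the old zigzag only `f ≫ l`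
remains. For a retract this composite is an idempotent, for a direct sum an identity or zero.
`snake_right_conj` is the mirror image, with `g ≫ h` inside. -/
lemma snake_left_conj {A B D E F G : C} (η : 𝟙_ C ⟶ A ⊗ B) (ε : D ⊗ E ⟶ 𝟙_ C)
    (f : A ⟶ F) (g : B ⟶ G) (h : G ⟶ D) (l : F ⟶ E) :
    G ◁ (η ≫ (f ⊗ₘ g)) ≫ (α_ _ _ _).inv ≫ ((h ⊗ₘ l) ≫ ε) ▷ G =
      h ▷ 𝟙_ C ≫ (D ◁ (η ≫ (f ≫ l) ▷ B) ≫ (α_ _ _ _).inv ≫ ε ▷ B) ≫ 𝟙_ C ◁ g := by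
  rw [MonoidalCategory.tensorHom_def, MonoidalCategory.tensorHom_def]
  simp only [comp_whiskerRight, MonoidalCategory.whiskerLeft_comp, Category.assoc]
  rw [associator_inv_naturality_right_assoc, whisker_exchange_assoc, whisker_exchange_assoc,
    whisker_exchange, ← associator_inv_naturality_left_assoc, whisker_exchange_assoc,
    whisker_exchange_assoc, ← associator_inv_naturality_middle_assoc]

lemma snake_right_conj {A B D E F G : C} (η : 𝟙_ C ⟶ A ⊗ B) (ε : D ⊗ E ⟶ 𝟙_ C)
    (f : A ⟶ F) (g : B ⟶ G) (h : G ⟶ D) (l : F ⟶ E) :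
    (η ≫ (f ⊗ₘ g)) ▷ F ≫ (α_ _ _ _).hom ≫ F ◁ ((h ⊗ₘ l) ≫ ε) =
      𝟙_ C ◁ l ≫ (η ▷ E ≫ (α_ _ _ _).hom ≫ A ◁ ((g ≫ h) ▷ E ≫ ε)) ≫ f ▷ 𝟙_ C := by
  rw [MonoidalCategory.tensorHom_def', MonoidalCategory.tensorHom_def']
  simp only [comp_whiskerRight, MonoidalCategory.whiskerLeft_comp, Category.assoc]
  rw [associator_naturality_left_assoc, ← whisker_exchange_assoc, ← whisker_exchange_assoc,
    ← whisker_exchange, ← associator_naturality_right_assoc, ← whisker_exchange_assoc,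
    ← whisker_exchange_assoc, associator_naturality_middle_assoc]

/-- `X` has a right dual. -/
def Dualizable (X : C) : Prop := ∃ Y : C, Nonempty (ExactPairing X Y)

/-- A retract of a dualizable object is dualizable if idempotents split. -/
lemma Dualizable.retract
    (hsplit : ∀ (X : C) (q : X ⟶ X), q ≫ q = q →
      ∃ (Y : C) (r : X ⟶ Y) (i : Y ⟶ X), i ≫ r = 𝟙 Y ∧ r ≫ i = q)
    {X Y : C} (hX : Dualizable X) (v : Y ⟶ X) (r : X ⟶ Y) (hv : v ≫ r = 𝟙 Y) :
    Dualizable Y := by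
  obtain ⟨X', ⟨hXX'⟩⟩ := hX
  let _ : HasRightDual X := ⟨X'⟩
  -- The dual of the retract is the image of the transposed idempotent on the dual of `X`.
  obtain ⟨Y', s, i, his, hsi⟩ := hsplit _ ((r ≫ v)ᘁ)
    (by rw [← comp_rightAdjointMate, Category.assoc, reassoc_of% hv])
  refine ⟨Y', ⟨⟨η_ X (Xᘁ) ≫ (r ⊗ₘ s), (i ⊗ₘ v) ≫ ε_ X (Xᘁ), ?_, ?_⟩⟩⟩
  · rw [snake_left_conj]
    -- A zigzag with `r ≫ v` inserted is by definition the transpose of `r ≫ v`; it equals `s ≫ i`,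
    -- which `i ≫ s = 𝟙` then absorbs.
    have h : ((Xᘁ : C) ◁ (η_ X (Xᘁ) ≫ (r ≫ v) ▷ (Xᘁ : C)) ≫ (α_ _ _ _).inv ≫ ε_ X (Xᘁ) ▷ (Xᘁ : C))
        = (ρ_ _).hom ≫ (r ≫ v)ᘁ ≫ (λ_ _).inv := by
      simp [rightAdjointMate]
    have his' {W : C} (g : Y' ⟶ W) : i ≫ s ≫ g = g := by rw [reassoc_of% his]
    rw [h, ← hsi]
    simp only [Category.assoc]
    rw [← rightUnitor_naturality_assoc, ← leftUnitor_inv_naturality]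
    simp [his']
  -- The transpose moves across the evaluation and becomes `r ≫ v` on `X`.
  · rw [snake_right_conj, hsi, rightAdjointMate_comp_evaluation]
    have h : (η_ X (Xᘁ) ▷ X ≫ (α_ _ _ _).hom ≫ X ◁ ((Xᘁ : C) ◁ (r ≫ v) ≫ ε_ X (Xᘁ)))
        = (λ_ _).hom ≫ (r ≫ v) ≫ (ρ_ _).inv := by
      rw [MonoidalCategory.whiskerLeft_comp, ← associator_naturality_right_assoc,
        ← whisker_exchange_assoc, ExactPairing.evaluation_coevaluation]
      simp
    have hv' {W : C} (g : Y ⟶ W) : v ≫ r ≫ g = g := by rw [reassoc_of% hv]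
    rw [h]
    simp [hv']

/-- A direct sum of dualizable objects is dualizable. -/
lemma Dualizable.directSum [Preadditive C] [MonoidalPreadditive C]
    (hsum : ∀ X Y : C, ∃ (Z : C) (u : X ⟶ Z) (v : Y ⟶ Z) (p : Z ⟶ X) (q : Z ⟶ Y),
      u ≫ p = 𝟙 X ∧ v ≫ q = 𝟙 Y ∧ u ≫ q = 0 ∧ v ≫ p = 0 ∧ p ≫ u + q ≫ v = 𝟙 Z)
    {X Y Z : C} (hX : Dualizable X) (hY : Dualizable Y)
    (u : X ⟶ Z) (v : Y ⟶ Z) (p : Z ⟶ X) (q : Z ⟶ Y) (hup : u ≫ p = 𝟙 X) (hvq : v ≫ q = 𝟙 Y)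
    (huq : u ≫ q = 0) (hvp : v ≫ p = 0) (hsumZ : p ≫ u + q ≫ v = 𝟙 Z) : Dualizable Z := by
  obtain ⟨X', ⟨hXX'⟩⟩ := hX
  obtain ⟨Y', ⟨hYY'⟩⟩ := hY
  obtain ⟨Z', u', v', p', q', hup', hvq', huq', hvp', hsumZ'⟩ := hsum X' Y'
  -- The dual is a direct sum of the duals. Each zigzag expands into four terms: mixed ones vanish
  -- by orthogonality, and the diagonal ones add up to a resolution of the identity.
  refine ⟨Z', ⟨⟨η_ X X' ≫ (u ⊗ₘ u') + η_ Y Y' ≫ (v ⊗ₘ v'),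
    (p' ⊗ₘ p) ≫ ε_ X X' + (q' ⊗ₘ q) ≫ ε_ Y Y', ?_, ?_⟩⟩⟩
  · rw [MonoidalPreadditive.whiskerLeft_add, MonoidalPreadditive.add_whiskerRight]
    simp only [Preadditive.add_comp, Preadditive.comp_add]
    simp only [snake_left_conj, hup, hvq, huq, hvp]
    have h : (ρ_ Z').hom ≫ (p' ≫ u' + q' ≫ v') ≫ (λ_ Z').inv = (ρ_ Z').hom ≫ (λ_ Z').inv := by
      rw [hsumZ', Category.id_comp]
    simpa using h
  · rw [MonoidalPreadditive.whiskerLeft_add, MonoidalPreadditive.add_whiskerRight]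
    simp only [Preadditive.add_comp, Preadditive.comp_add]
    simp only [snake_right_conj, hup', hvq', huq', hvp']
    have h : (λ_ Z).hom ≫ (p ≫ u + q ≫ v) ≫ (ρ_ Z).inv = (λ_ Z).hom ≫ (ρ_ Z).inv := by
      rw [hsumZ, Category.id_comp]
    simpa using h

end Duality

/-! ### Duality and conjugates in C*-tensor categories -/

section Conjugates

variable {C : Type*} [Category C] [HasDagNorm C]

section Monoidal

variable [MonoidalCategory C]

lemma IsConjugate.symm {X Y : C} (h : IsConjugate X Y) : IsConjugate Y X := by
  obtain ⟨R, R', h⟩ := h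
  exact ⟨R', R, And.symm h⟩

lemma isConjugate_fullSubcategory {P : ObjectProperty C} [P.IsMonoidal] {X Y : P.FullSubcategory}
    (h : IsConjugate X.obj Y.obj) : IsConjugate X Y := by
  obtain ⟨R, R', h₁, h₂⟩ := h
  exact ⟨ObjectProperty.homMk R, ObjectProperty.homMk R', ObjectProperty.hom_ext _ h₁,
    ObjectProperty.hom_ext _ h₂⟩

end Monoidal

variable [Preadditive C] [Linear ℂ C]

lemma IsCStarCategory.dag_eq_inv (hC : IsCStarCategory C) {X Y : C} {e : X ≅ Y}
    (he : IsUnitaryMor e.hom) : dag e.hom = e.inv ∧ dag e.inv = e.hom := by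
  have h : dag e.hom = e.inv := by rw [← cancel_epi e.hom, he.1, e.hom_inv_id]
  exact ⟨h, by rw [← h, hC.dag_dag]⟩

/-- Composing `u` with the resolution of the identity gives `u + u ≫ dag v ≫ v = u`; then `v ≫ dag v
= 𝟙` cancels the last `v`. -/
lemma IsCStarCategory.comp_dag_eq_zero (hC : IsCStarCategory C) {X Y Z : C} {u : X ⟶ Z}
    {v : Y ⟶ Z} (hu : IsIsometry u) (hv : IsIsometry v)
    (h : dag u ≫ u + dag v ≫ v = 𝟙 Z) : u ≫ dag v = 0 ∧ v ≫ dag u = 0 := by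
  have h₁ : u ≫ dag v ≫ v = 0 := by
    have := congrArg (u ≫ ·) h
    rw [IsIsometry] at hu
    simpa [Preadditive.comp_add, reassoc_of% hu] using this
  have h₂ : u ≫ dag v = 0 := by
    have := congrArg (· ≫ dag v) h₁
    rw [IsIsometry] at hv
    simpa [hv] using this
  refine ⟨h₂, ?_⟩
  have h₃ := congrArg dag h₂
  rw [hC.dag_comp, hC.dag_dag] at h₃
  rw [h₃]
  simpa using hC.dag_smul 0 (0 : X ⟶ Y)

namespace IsCStarTensorCategory

variable [MonoidalCategory C] (hC : IsCStarTensorCategory C)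

include hC

lemma monoidalPreadditive : MonoidalPreadditive C where
  whiskerLeft_add f g := by simpa using hC.tensor_add (𝟙 _) f g
  add_whiskerRight f g := by simpa using hC.add_tensor f g (𝟙 _)
  whiskerLeft_zero {X Y Z} := by simpa using hC.tensor_smul 0 (𝟙 X) (0 : Y ⟶ Z)
  zero_whiskerRight {X Y Z} := by simpa using hC.smul_tensor 0 (0 : Y ⟶ Z) (𝟙 X)

lemma dag_whiskerLeft (X : C) {Y Z : C} (T : Y ⟶ Z) : dag (X ◁ T) = X ◁ dag T := by
  rw [← id_tensorHom, hC.dag_tensor, hC.dag_id, id_tensorHom]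

lemma dag_whiskerRight {Y Z : C} (T : Y ⟶ Z) (X : C) : dag (T ▷ X) = dag T ▷ X := by
  rw [← tensorHom_id, hC.dag_tensor, hC.dag_id, tensorHom_id]

/-- Coevaluation `R'`, evaluation `R*`. The first conjugate equation is a zigzag identity up to
unitors. The second involves `R` and `R'*`, so it is the adjoint of the other zigzag; unitarity of
the constraints makes their adjoints their inverses. -/
lemma isConjugate_iff_exactPairing {X Y : C} :
    IsConjugate X Y ↔ Nonempty (ExactPairing X Y) := by
  have hα := hC.dag_eq_inv (hC.associator_unitary X Y X)
  have hl := hC.dag_eq_inv (hC.leftUnitor_unitary X)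
  have hr := hC.dag_eq_inv (hC.rightUnitor_unitary X)
  have key₁ (R : 𝟙_ C ⟶ Y ⊗ X) (R' : 𝟙_ C ⟶ X ⊗ Y) :
      (ρ_ Y).inv ≫ (Y ◁ R') ≫ (α_ Y X Y).inv ≫ (dag R ▷ Y) ≫ (λ_ Y).hom = 𝟙 Y ↔
        Y ◁ R' ≫ (α_ _ _ _).inv ≫ dag R ▷ Y = (ρ_ Y).hom ≫ (λ_ Y).inv := by
    rw [Iso.inv_comp_eq, Iso.eq_comp_inv]
    simp
  have key₂ (R : 𝟙_ C ⟶ Y ⊗ X) (R' : 𝟙_ C ⟶ X ⊗ Y) :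
      (ρ_ X).inv ≫ (X ◁ R) ≫ (α_ X Y X).inv ≫ (dag R' ▷ X) ≫ (λ_ X).hom = 𝟙 X ↔
        R' ▷ X ≫ (α_ _ _ _).hom ≫ X ◁ dag R = (λ_ X).hom ≫ (ρ_ X).inv := by
    have hinj {A B : C} (S T : A ⟶ B) : S = T ↔ dag S = dag T :=
      ⟨congrArg dag, fun h => by rw [← hC.dag_dag S, h, hC.dag_dag]⟩
    rw [hinj]
    simp only [hC.dag_comp, hC.dag_id, hC.dag_whiskerLeft, hC.dag_whiskerRight, hα, hl, hr,
      hC.dag_dag, Category.assoc]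
    rw [Iso.inv_comp_eq, Iso.eq_comp_inv]
    simp
  constructor
  · rintro ⟨R, R', h₁, h₂⟩
    exact ⟨⟨R', dag R, (key₁ R R').1 h₁, (key₂ R R').1 h₂⟩⟩
  · rintro ⟨h⟩
    refine ⟨dag (ε_ X Y), η_ X Y, (key₁ _ _).2 ?_, (key₂ _ _).2 ?_⟩
    · rw [hC.dag_dag]; exact ExactPairing.coevaluation_evaluation X Y
    · rw [hC.dag_dag]; exact ExactPairing.evaluation_coevaluation X Y

lemma exists_isConjugate_iff_dualizable {X : C} : (∃ Y, IsConjugate X Y) ↔ Dualizable X :=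
  exists_congr fun _ => hC.isConjugate_iff_exactPairing

lemma dualizable_directSum {X Y Z : C} (hX : Dualizable X) (hY : Dualizable Y)
    {u : X ⟶ Z} {v : Y ⟶ Z} (hu : IsIsometry u) (hv : IsIsometry v)
    (h : dag u ≫ u + dag v ≫ v = 𝟙 Z) : Dualizable Z := by
  have := hC.monoidalPreadditive
  have h₀ := hC.comp_dag_eq_zero hu hv h
  refine hX.directSum (fun X Y => ?_) hY u v (dag u) (dag v) hu hv h₀.1 h₀.2 h
  obtain ⟨Z, u, v, hu, hv, h⟩ := hC.exists_directSum X Y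
  have h₀ := hC.comp_dag_eq_zero hu hv h
  exact ⟨Z, u, v, dag u, dag v, hu, hv, h₀.1, h₀.2, h⟩

/-- A full monoidal subcategory that is closed under direct sums and subobjects is a C*-tensor
category. -/
theorem fullSubcategory (P : ObjectProperty C) [P.IsMonoidal]
    (hsum : ∀ (X Y Z : C) (u : X ⟶ Z) (v : Y ⟶ Z), P X → P Y → IsIsometry u → IsIsometry v →
      dag u ≫ u + dag v ≫ v = 𝟙 Z → P Z)
    (hsub : ∀ (X Y : C) (v : Y ⟶ X), P X → IsIsometry v → P Y) :
    IsCStarTensorCategory P.FullSubcategory where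
  mnorm_eq_zero_iff T := (hC.mnorm_eq_zero_iff T.hom).trans
    ⟨fun h => ObjectProperty.hom_ext _ h, fun h => by rw [h]; rfl⟩
  mnorm_add_le S T := hC.mnorm_add_le S.hom T.hom
  mnorm_smul z T := hC.mnorm_smul z T.hom
  complete u hu := by
    obtain ⟨T, hT⟩ := hC.complete (fun n => (u n).hom) hu
    exact ⟨ObjectProperty.homMk T, hT⟩
  mnorm_comp_le T S := hC.mnorm_comp_le T.hom S.hom
  dag_add S T := ObjectProperty.hom_ext _ (hC.dag_add S.hom T.hom)
  dag_smul z T := ObjectProperty.hom_ext _ (hC.dag_smul z T.hom)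
  dag_id X := ObjectProperty.hom_ext _ (hC.dag_id X.obj)
  dag_comp T S := ObjectProperty.hom_ext _ (hC.dag_comp T.hom S.hom)
  dag_dag T := ObjectProperty.hom_ext _ (hC.dag_dag T.hom)
  cstar T := hC.cstar T.hom
  positive T := by
    obtain ⟨S, hS⟩ := hC.positive T.hom
    exact ⟨ObjectProperty.homMk S, ObjectProperty.hom_ext _ hS⟩
  add_tensor S T R := ObjectProperty.hom_ext _ (hC.add_tensor S.hom T.hom R.hom)
  tensor_add R S T := ObjectProperty.hom_ext _ (hC.tensor_add R.hom S.hom T.hom)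
  smul_tensor z S T := ObjectProperty.hom_ext _ (hC.smul_tensor z S.hom T.hom)
  tensor_smul z S T := ObjectProperty.hom_ext _ (hC.tensor_smul z S.hom T.hom)
  dag_tensor S T := ObjectProperty.hom_ext _ (hC.dag_tensor S.hom T.hom)
  associator_unitary X Y Z :=
    ⟨ObjectProperty.hom_ext _ (hC.associator_unitary X.obj Y.obj Z.obj).1,
      ObjectProperty.hom_ext _ (hC.associator_unitary X.obj Y.obj Z.obj).2⟩
  leftUnitor_unitary X :=
    ⟨ObjectProperty.hom_ext _ (hC.leftUnitor_unitary X.obj).1,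
      ObjectProperty.hom_ext _ (hC.leftUnitor_unitary X.obj).2⟩
  rightUnitor_unitary X :=
    ⟨ObjectProperty.hom_ext _ (hC.rightUnitor_unitary X.obj).1,
      ObjectProperty.hom_ext _ (hC.rightUnitor_unitary X.obj).2⟩
  exists_directSum X Y := by
    obtain ⟨Z, u, v, hu, hv, h⟩ := hC.exists_directSum X.obj Y.obj
    exact ⟨⟨Z, hsum _ _ Z u v X.property Y.property hu hv h⟩, ObjectProperty.homMk u,
      ObjectProperty.homMk v, ObjectProperty.hom_ext _ hu, ObjectProperty.hom_ext _ hv,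
      ObjectProperty.hom_ext _ h⟩
  exists_subobject X p hp hpp := by
    obtain ⟨Y, v, hv, h⟩ := hC.exists_subobject X.obj p.hom
      (congrArg InducedCategory.Hom.hom hp) (congrArg InducedCategory.Hom.hom hpp)
    exact ⟨⟨Y, hsub _ Y v X.property hv⟩, ObjectProperty.homMk v, ObjectProperty.hom_ext _ hv,
      ObjectProperty.hom_ext _ h⟩
  id_unit_ne_zero h := hC.id_unit_ne_zero
    (congrArg (fun T : 𝟙_ P.FullSubcategory ⟶ 𝟙_ P.FullSubcategory => T.hom) h)
  end_unit T := by
    obtain ⟨z, hz⟩ := hC.end_unit T.hom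
    exact ⟨z, ObjectProperty.hom_ext _ hz⟩

end IsCStarTensorCategory

end Conjugates

/-! ### The category `α` -/

section Alpha

variable {Q : Type*} [CStarAlgebra Q]

/-- The conjugate equation makes `y ↦ (x ↦ R* (y ⊗ x))` injective. -/
lemma SolvesConjugateEquations.finrank_le {X Y : UnitaryPair Q} {R : 𝟙_ (UnitaryPair Q) ⟶ Y ⊗ X}
    {R' : 𝟙_ (UnitaryPair Q) ⟶ X ⊗ Y} (h : SolvesConjugateEquations R R') :
    Module.finrank ℂ Y.H ≤ Module.finrank ℂ X.H := by
  let f : Y.H →ₗ[ℂ] Module.Dual ℂ X.H := TensorProduct.curry (op (dag R))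
  have hf : Function.Injective f := by
    rw [injective_iff_map_eq_zero]
    intro y hy
    have hzero (t : X.H ⊗[ℂ] Y.H) : TensorProduct.lid ℂ Y.H (LinearMap.rTensor Y.H (op (dag R))
        ((TensorProduct.assoc ℂ Y.H X.H Y.H).symm (y ⊗ₜ[ℂ] t))) = 0 := by
      induction t using TensorProduct.induction_on with
      | zero => simp
      | add s t hs ht => rw [TensorProduct.tmul_add, map_add, map_add, map_add, hs, ht, add_zero]
      | tmul x z =>
        have hx : op (dag R) (y ⊗ₜ[ℂ] x) = (0 : ℂ) := LinearMap.congr_fun hy x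
        rw [TensorProduct.assoc_symm_tmul, LinearMap.rTensor_tmul, hx]
        simp
    -- The first conjugate equation at `y` reads `y = (R* ⊗ id)(y ⊗ R'(1))`, which vanishes once
    -- `R*(y ⊗ ·) = 0`.
    exact (LinearMap.congr_fun (congrArg op h.1) y).symm.trans (hzero (op R' (1 : ℂ)))
  exact (LinearMap.finrank_le_finrank_of_injective hf).trans_eq Subspace.dual_finrank_eq

lemma finrank_conjSpace (H : Type) [NormedAddCommGroup H] [InnerProductSpace ℂ H]
    : Module.finrank ℂ (ConjSpace H) = Module.finrank ℂ H :=
  congrArg Cardinal.toNat (rank_eq_of_equiv_equiv (starRingEnd ℂ) (toConjSpace H).symm.toAddEquiv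
    (starRingAut (R := ℂ)).bijective fun z x => (toConjSpace H).symm.map_smulₛₗ z x)

/-- A pair belongs to `α` if and only if it has a conjugate among all pairs. -/
lemma hasConj_iff {X : UnitaryPair Q} : hasConj Q X ↔ ∃ Y, IsConjugate X Y := by
  constructor
  · rintro ⟨Ubar, Rs, Rt, h⟩
    exact ⟨conjPair X Ubar, Rs, Rt, h⟩
  · rintro ⟨Y, hXY⟩
    obtain ⟨R, R', h⟩ := id hXY
    -- The dimension bound is applied twice, the second time with `R` and `R'` exchanged.
    have hdim : Module.finrank ℂ (ConjSpace X.H) = Module.finrank ℂ Y.H :=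
      (finrank_conjSpace X.H).trans (le_antisymm (SolvesConjugateEquations.finrank_le (And.symm h))
        h.finrank_le)
    let e := (stdOrthonormalBasis ℂ (ConjSpace X.H)).equiv (stdOrthonormalBasis ℂ Y.H)
      (finCongr hdim)
    have he := adjoint_linearIsometryEquiv e
    -- Restriction along a surjective isometry `e` is conjugation by it: `e e* = 1` commutes with
    -- everything.
    obtain ⟨W, hW⟩ := exists_unitary_restrict Y.U e.toLinearEquiv.toLinearMap
      (by rw [he]; ext x; simp)
      (by
        have h : e.toLinearEquiv.toLinearMap ∘ₗ e.symm.toLinearEquiv.toLinearMap =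
            LinearMap.id := by ext x; simp
        rw [he, h]
        exact Intertwines.id Y.U.1)
    have hC := isCStarTensorCategory_unitaryPair (Q := Q)
    obtain ⟨_⟩ := hC.isConjugate_iff_exactPairing.1 hXY
    let i : conjPair X W ≅ Y := mkIso e.toLinearEquiv hW
    obtain ⟨Rs, Rt, hR⟩ := hC.isConjugate_iff_exactPairing.2 ⟨exactPairingCongrRight (X := X) i⟩
    exact ⟨W, Rs, Rt, hR⟩

/-- Membership in `α` becomes a purely monoidal property, free of adjoints and conjugate Hilbert
spaces. -/
lemma hasConj_iff_dualizable {X : UnitaryPair Q} : hasConj Q X ↔ Dualizable X :=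
  hasConj_iff.trans isCStarTensorCategory_unitaryPair.exists_isConjugate_iff_dualizable

lemma hasConj_of_isConjugate {X Y : UnitaryPair Q} (h : IsConjugate X Y) : hasConj Q Y :=
  hasConj_iff.2 ⟨X, h.symm⟩

instance isMonoidal_hasConj : (hasConj Q).IsMonoidal where
  prop_unit := hasConj_iff_dualizable.2 ⟨_, ⟨exactPairingUnit⟩⟩
  prop_tensor X Y hX hY := by
    obtain ⟨X', ⟨_⟩⟩ := hasConj_iff_dualizable.1 hX
    obtain ⟨Y', ⟨_⟩⟩ := hasConj_iff_dualizable.1 hY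
    exact hasConj_iff_dualizable.2 ⟨_, ⟨ExactPairing.tensor (Y₁ := X') (Y₂ := Y')⟩⟩

lemma hasConj_directSum {X Y Z : UnitaryPair Q} {u : X ⟶ Z} {v : Y ⟶ Z} (hX : hasConj Q X)
    (hY : hasConj Q Y) (hu : IsIsometry u) (hv : IsIsometry v)
    (h : dag u ≫ u + dag v ≫ v = 𝟙 Z) : hasConj Q Z :=
  hasConj_iff_dualizable.2 (isCStarTensorCategory_unitaryPair.dualizable_directSum
    (hasConj_iff_dualizable.1 hX) (hasConj_iff_dualizable.1 hY) hu hv h)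

lemma hasConj_subobject {X Y : UnitaryPair Q} {v : Y ⟶ X} (hX : hasConj Q X)
    (hv : IsIsometry v) : hasConj Q Y := by
  refine hasConj_iff_dualizable.2 ((hasConj_iff_dualizable.1 hX).retract (fun X q hq => ?_) v
    (dag v) hv)
  obtain ⟨Z, w, hw, hwq, hqw⟩ := exists_splitting q hq
  rw [IsIsometry] at hw
  -- `dag w` alone would split the orthogonal projection onto the range of `q`; precomposing with
  -- `q` splits `q` itself.
  exact ⟨Z, q ≫ dag w, w, by rw [reassoc_of% hwq, hw], by rw [Category.assoc, hqw]⟩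

theorem isRigidCStarTensorCategory_alpha : IsRigidCStarTensorCategory (Alpha Q) where
  toIsCStarTensorCategory := isCStarTensorCategory_unitaryPair.fullSubcategory (hasConj Q)
    (fun _ _ _ _ _ => hasConj_directSum) (fun _ _ _ => hasConj_subobject)
  exists_conjugate X := by
    obtain ⟨Y, hY⟩ := hasConj_iff.1 X.property
    -- The conjugate found among all pairs lies in `α` by symmetry, and fullness makes `R` and `R'`
    -- morphisms of `α`.
    exact ⟨⟨Y, hasConj_of_isConjugate hY⟩, isConjugate_fullSubcategory hY⟩

end Alpha

end AlphaCat

end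

theorem mainTheorem4 (Q : Type*) [CStarAlgebra Q] :
    -- `α` contains the unit `(1, ℂ)` and is closed under tensor products `(U₁₃ V₂₃, H ⊗ K)`
    ∃ _ : (AlphaCat.hasConj Q).IsMonoidal,
      -- with the inherited tensor product, `α` is a rigid C*-tensor category
      AlphaCat.IsRigidCStarTensorCategory (AlphaCat.Alpha Q) ∧
      -- strictness: the constraints are the canonical identifications of Hilbert spaces
      (∀ X Y Z : AlphaCat.Alpha Q, AlphaCat.op (α_ X Y Z).hom.hom =
        (TensorProduct.assoc ℂ X.obj.H Y.obj.H Z.obj.H).toLinearMap) ∧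
      (∀ X : AlphaCat.Alpha Q,
        AlphaCat.op (λ_ X).hom.hom = (TensorProduct.lid ℂ X.obj.H).toLinearMap) ∧
      (∀ X : AlphaCat.Alpha Q,
        AlphaCat.op (ρ_ X).hom.hom = (TensorProduct.rid ℂ X.obj.H).toLinearMap) ∧
      -- closed under direct sums
      (∀ (X Y Z : AlphaCat.UnitaryPair Q) (u : X ⟶ Z) (v : Y ⟶ Z),
        AlphaCat.hasConj Q X → AlphaCat.hasConj Q Y →
        AlphaCat.IsIsometry u → AlphaCat.IsIsometry v →
        AlphaCat.HasDagNorm.dag u ≫ u + AlphaCat.HasDagNorm.dag v ≫ v = 𝟙 Z →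
        AlphaCat.hasConj Q Z) ∧
      -- closed under subobjects
      (∀ (X Y : AlphaCat.UnitaryPair Q) (v : Y ⟶ X),
        AlphaCat.hasConj Q X → AlphaCat.IsIsometry v → AlphaCat.hasConj Q Y) ∧
      -- closed under conjugates
      (∀ X Y : AlphaCat.UnitaryPair Q,
        AlphaCat.hasConj Q X → AlphaCat.IsConjugate X Y → AlphaCat.hasConj Q Y) :=
  ⟨AlphaCat.isMonoidal_hasConj, AlphaCat.isRigidCStarTensorCategory_alpha,
    fun _ _ _ => rfl, fun _ => rfl, fun _ => rfl,
    fun _ _ _ _ _ => AlphaCat.hasConj_directSum, fun _ _ _ => AlphaCat.hasConj_subobject,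
    fun _ _ _ => AlphaCat.hasConj_of_isConjugate⟩
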